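/- \textbf{Lifting lemma.} Let $\mathbf{k}$ be a field of characteristic zero and let $\mathbf{C}$ be a set of colors. By a colored dg-operad we mean a (symmetric, unital) $\mathbf{C}$-colored operad $\mathcal{P}=\{\mathcal{P}(c_1,\dots,c_n;c)\}_{n\ge 0}$ in the category of $\mathbb{Z}$-graded chain complexes over $\mathbf{k}$ (differential of degree $-1$); forgetting the differentials gives its underlying graded operad. Morphisms preserve degrees, differentials, compositions, units and symmetric group actions. A graded colored collection is a system of $\mathbb{Z}$-graded $\mathbf{k}$-vector spaces $E=\{E(c_1,\dots,c_n;c)\}$ with the right actions of the symmetric groups permuting the input colors; $\Gamma(E)$ denotes the free graded colored operad on $E$, and $*$ denotes the free product (coproduct) of graded colored operads. A morphism of colored dg-operads $\iota:\mathcal{S}\to\mathcal{Q}$ is an \emph{elemental cofibration} if, up to isomorphism, the underlying graded operad of $\mathcal{Q}$ is $\mathcal{S}*\Gamma(E)$ for a graded colored collection $E$, with $\iota$ the canonical inclusion of $\mathcal{S}$, and $E$ decomposes as a direct sum of subcollections $E=\bigoplus_{n\ge 0}E_n$ such that, for every $n\ge 0$, $\partial(E_n)$ is contained in $\mathcal{S}*\Gamma(E)_{<n}$,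 that is, in the graded suboperad of $\mathcal{Q}$ generated by $\mathcal{S}$ and $\bigoplus_{j<n}E_j$. Let $$\begin{array}{ccc}\mathcal{S}&\xrightarrow{\ f\ }&\mathcal{X}\\ {\scriptstyle\iota}\downarrow&&\downarrow{\scriptstyle p}\\ \mathcal{Q}&\xrightarrow{\ g\ }&\mathcal{Y}\end{array}$$ be a commutative square of morphisms of $\mathbf{C}$-colored dg-operads ($pf=g\iota$), in which $\iota$ is an elemental cofibration and $p$ is surjective (on every component $\mathcal{X}(c_1,\dots,c_n;c)$, in every degree) and induces an isomorphism on the homology of every component. Then there exists a morphism of colored dg-operads $h:\mathcal{Q}\to\mathcal{X}$ such that $h\iota=f$ and $ph=g$. -/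

import Mathlib

universe u v w w₁ w₂ w₃ w₄

/-- A graded `C`-coloured collection: graded `k`-vector spaces `obj c c₀ p` (input colours
`c 0, …, c (n-1)`, output colour `c₀`, degree `p`) with the right action of the symmetric groups,
which permutes the input colours: input `s` of `x · σ` is input `σ s` of `x`. -/
structure GradedCollection (k : Type u) [Field k] (C : Type v) where
  obj : {n : ℕ} → (Fin n → C) → C → ℤ → Type w
  [addCommGroup : ∀ {n : ℕ} (c : Fin n → C) (c₀ : C) (p : ℤ), AddCommGroup (obj c c₀ p)]
  [module : ∀ {n : ℕ} (c : Fin n → C) (c₀ : C) (p : ℤ), Module k (obj c c₀ p)]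
  act : ∀ {n : ℕ} {c c' : Fin n → C} {c₀ : C} {p : ℤ} (σ : Equiv.Perm (Fin n)),
    (∀ s, c' s = c (σ s)) → (obj c c₀ p →ₗ[k] obj c' c₀ p)
  act_refl : ∀ {n : ℕ} {c : Fin n → C} {c₀ : C} {p : ℤ} (h : ∀ s, c s = c ((1 : Equiv.Perm (Fin n)) s))
    (x : obj c c₀ p), act 1 h x = x
  act_act : ∀ {n : ℕ} {c c' c'' : Fin n → C} {c₀ : C} {p : ℤ} (σ τ : Equiv.Perm (Fin n))
    (h : ∀ s, c' s = c (σ s)) (h' : ∀ s, c'' s = c' (τ s)) (h'' : ∀ s, c'' s = c ((σ * τ) s))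
    (x : obj c c₀ p), act τ h' (act σ h x) = act (σ * τ) h'' x

attribute [instance] GradedCollection.addCommGroup GradedCollection.module

/-- The combinatorial data needed to plug an operation with inputs `d` and output `d₀` into the
`i`-th input of an operation with inputs `c`, giving an operation with inputs `b`: the colours of
the plugged ends agree, and `pos` says at which places of the result the remaining inputs of the
first operation and the inputs of the second one are put.  The usual partial composition `∘ᵢ` is
the case in which the inputs of the second operation are put, in their order, in the place of
input `i`; every other `pos` differs from it by a permutation of the inputs of the result. -/
structure Grafting {C : Type v} {m n l : ℕ} (c : Fin m → C) (i : Fin m) (d : Fin n → C) (d₀ : C)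
    (b : Fin l → C) where
  pos : {s : Fin m // s ≠ i} ⊕ Fin n ≃ Fin l
  output : d₀ = c i
  left : ∀ s : {s : Fin m // s ≠ i}, b (pos (Sum.inl s)) = c s.1
  right : ∀ t : Fin n, b (pos (Sum.inr t)) = d t

namespace Grafting

variable {C : Type v}

/-- The numbering `B` is the numbering `A` followed by the permutation `σ` of inputs. -/
def IsPermuted {m n l : ℕ} {c : Fin m → C} {i : Fin m} {d : Fin n → C} {d₀ : C}
    {b b' : Fin l → C} (σ : Equiv.Perm (Fin l)) (A : Grafting c i d d₀ b)
    (B : Grafting c i d d₀ b') : Prop :=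
  ∀ t, σ (B.pos t) = A.pos t

/-- Plugging into `x · σ` at `i` numbered by `A` is plugging into `x` at `σ i` numbered by `B`. -/
def IsPermutedLeft {m n l : ℕ} {c c' : Fin m → C} {i : Fin m} {d : Fin n → C} {d₀ : C}
    {b : Fin l → C} (σ : Equiv.Perm (Fin m)) (A : Grafting c' i d d₀ b)
    (B : Grafting c (σ i) d d₀ b) : Prop :=
  (∀ s (hs : s ≠ i) (hs' : σ s ≠ σ i), A.pos (Sum.inl ⟨s, hs⟩) = B.pos (Sum.inl ⟨σ s, hs'⟩)) ∧
  ∀ t, A.pos (Sum.inr t) = B.pos (Sum.inr t)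

/-- Plugging in `y · τ` numbered by `A` is plugging in `y` numbered by `B`. -/
def IsPermutedRight {m n l : ℕ} {c : Fin m → C} {i : Fin m} {d d' : Fin n → C} {d₀ : C}
    {b : Fin l → C} (τ : Equiv.Perm (Fin n)) (A : Grafting c i d' d₀ b)
    (B : Grafting c i d d₀ b) : Prop :=
  (∀ s, A.pos (Sum.inl s) = B.pos (Sum.inl s)) ∧
  ∀ t, A.pos (Sum.inr t) = B.pos (Sum.inr (τ t))

/-- Plugging `y` into input `i` of `x` (by `A`) and `z` into input `j` of `y` (by `A'`) gives the
same numbering of the inputs as plugging `z` into `y` first (by `B`) and the result into `x`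
(by `B'`). -/
def IsSequential {m n l r s N : ℕ} {c : Fin m → C} {i : Fin m} {d : Fin n → C} {d₀ : C}
    {b : Fin l → C} {j : Fin n} {a : Fin r → C} {a₀ : C} {b' : Fin s → C} {o : Fin N → C}
    (A : Grafting c i d d₀ b) (A' : Grafting b (A.pos (Sum.inr j)) a a₀ o)
    (B : Grafting d j a a₀ b') (B' : Grafting c i b' d₀ o) : Prop :=
  (∀ t (ht : A.pos (Sum.inl t) ≠ A.pos (Sum.inr j)),
    A'.pos (Sum.inl ⟨A.pos (Sum.inl t), ht⟩) = B'.pos (Sum.inl t)) ∧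
  (∀ t (ht : t ≠ j) (ht' : A.pos (Sum.inr t) ≠ A.pos (Sum.inr j)),
    A'.pos (Sum.inl ⟨A.pos (Sum.inr t), ht'⟩) = B'.pos (Sum.inr (B.pos (Sum.inl ⟨t, ht⟩)))) ∧
  ∀ t, A'.pos (Sum.inr t) = B'.pos (Sum.inr (B.pos (Sum.inr t)))

/-- Plugging `y` into input `i` of `x` (by `A`) and then `z` into another input `j` of `x`
(by `A'`) gives the same numbering of the inputs as doing the same in the other order
(by `B`, `B'`). -/
def IsParallel {m n l r s N : ℕ} {c : Fin m → C} {i j : Fin m} (hij : i ≠ j) (hji : j ≠ i)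
    {d : Fin n → C} {d₀ : C} {b : Fin l → C} {a : Fin r → C} {a₀ : C} {b' : Fin s → C}
    {o : Fin N → C}
    (A : Grafting c i d d₀ b) (A' : Grafting b (A.pos (Sum.inl ⟨j, hji⟩)) a a₀ o)
    (B : Grafting c j a a₀ b') (B' : Grafting b' (B.pos (Sum.inl ⟨i, hij⟩)) d d₀ o) : Prop :=
  (∀ t (hi : t ≠ i) (hj : t ≠ j)
      (h : A.pos (Sum.inl ⟨t, hi⟩) ≠ A.pos (Sum.inl ⟨j, hji⟩))
      (h' : B.pos (Sum.inl ⟨t, hj⟩) ≠ B.pos (Sum.inl ⟨i, hij⟩)),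
    A'.pos (Sum.inl ⟨A.pos (Sum.inl ⟨t, hi⟩), h⟩) =
      B'.pos (Sum.inl ⟨B.pos (Sum.inl ⟨t, hj⟩), h'⟩)) ∧
  (∀ t (h : A.pos (Sum.inr t) ≠ A.pos (Sum.inl ⟨j, hji⟩)),
    A'.pos (Sum.inl ⟨A.pos (Sum.inr t), h⟩) = B'.pos (Sum.inr t)) ∧
  ∀ t (h : B.pos (Sum.inr t) ≠ B.pos (Sum.inl ⟨i, hij⟩)),
    A'.pos (Sum.inr t) = B'.pos (Sum.inl ⟨B.pos (Sum.inr t), h⟩)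

end Grafting

/-- The sign `(-1)^n` in `k`. -/
def koszulSign (k : Type u) [Field k] (n : ℤ) : k := ((n.negOnePow : ℤ) : k)

/-- A unital `C`-coloured operad in graded `k`-vector spaces, presented by its partial
compositions (with arbitrary numbering of the inputs of the result), symmetric group actions and
units. -/
structure GradedOperad (k : Type u) [Field k] (C : Type v) extends GradedCollection.{u, v, w} k C
    where
  one : ∀ c : C, obj (fun _ : Fin 1 => c) c 0
  comp : ∀ {m n l : ℕ} {c : Fin m → C} {c₀ : C} {i : Fin m} {d : Fin n → C} {d₀ : C}
    {b : Fin l → C} {p q r : ℤ}, Grafting c i d d₀ b → p + q = r →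
    (obj c c₀ p →ₗ[k] obj d d₀ q →ₗ[k] obj b c₀ r)
  act_comp : ∀ {m n l : ℕ} {c : Fin m → C} {c₀ : C} {i : Fin m} {d : Fin n → C} {d₀ : C}
    {b b' : Fin l → C} {p q r : ℤ} (hr : p + q = r) (σ : Equiv.Perm (Fin l))
    (h : ∀ s, b' s = b (σ s)) (A : Grafting c i d d₀ b) (B : Grafting c i d d₀ b'),
    A.IsPermuted σ B → ∀ (x : obj c c₀ p) (y : obj d d₀ q),
    act σ h (comp A hr x y) = comp B hr x y
  comp_act_left : ∀ {m n l : ℕ} {c c' : Fin m → C} {c₀ : C} {i : Fin m} {d : Fin n → C} {d₀ : C}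
    {b : Fin l → C} {p q r : ℤ} (hr : p + q = r) (σ : Equiv.Perm (Fin m))
    (h : ∀ s, c' s = c (σ s)) (A : Grafting c' i d d₀ b) (B : Grafting c (σ i) d d₀ b),
    A.IsPermutedLeft σ B → ∀ (x : obj c c₀ p) (y : obj d d₀ q),
    comp A hr (act σ h x) y = comp B hr x y
  comp_act_right : ∀ {m n l : ℕ} {c : Fin m → C} {c₀ : C} {i : Fin m} {d d' : Fin n → C} {d₀ : C}
    {b : Fin l → C} {p q r : ℤ} (hr : p + q = r) (τ : Equiv.Perm (Fin n))
    (h : ∀ s, d' s = d (τ s)) (A : Grafting c i d' d₀ b) (B : Grafting c i d d₀ b),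
    A.IsPermutedRight τ B → ∀ (x : obj c c₀ p) (y : obj d d₀ q),
    comp A hr x (act τ h y) = comp B hr x y
  comp_one : ∀ {m : ℕ} {c b : Fin m → C} {c₀ c₁ : C} {i : Fin m} {p : ℤ} (hp : p + 0 = p)
    (A : Grafting c i (fun _ : Fin 1 => c₁) c₁ b) (σ : Equiv.Perm (Fin m))
    (h : ∀ s, b s = c (σ s)),
    (∀ s, σ (A.pos (Sum.inl s)) = s.1) → σ (A.pos (Sum.inr 0)) = i →
    ∀ x : obj c c₀ p, comp A hp x (one c₁) = act σ h x
  one_comp : ∀ {n : ℕ} {d b : Fin n → C} {c₀ : C} {i : Fin 1} {q : ℤ} (hq : 0 + q = q)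
    (A : Grafting (fun _ : Fin 1 => c₀) i d c₀ b) (σ : Equiv.Perm (Fin n))
    (h : ∀ s, b s = d (σ s)), (∀ t, σ (A.pos (Sum.inr t)) = t) →
    ∀ y : obj d c₀ q, comp A hq (one c₀) y = act σ h y
  assoc_seq : ∀ {m n l r s N : ℕ} {c : Fin m → C} {c₀ : C} {i : Fin m} {d : Fin n → C} {d₀ : C}
    {b : Fin l → C} {j : Fin n} {a : Fin r → C} {a₀ : C} {b' : Fin s → C} {o : Fin N → C}
    {p q e pq qe t : ℤ} (h₁ : p + q = pq) (h₂ : pq + e = t) (h₃ : q + e = qe) (h₄ : p + qe = t)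
    (A : Grafting c i d d₀ b) (A' : Grafting b (A.pos (Sum.inr j)) a a₀ o)
    (B : Grafting d j a a₀ b') (B' : Grafting c i b' d₀ o),
    Grafting.IsSequential A A' B B' → ∀ (x : obj c c₀ p) (y : obj d d₀ q) (z : obj a a₀ e),
    comp A' h₂ (comp A h₁ x y) z = comp B' h₄ x (comp B h₃ y z)
  assoc_par : ∀ {m n l r s N : ℕ} {c : Fin m → C} {c₀ : C} {i j : Fin m} (hij : i ≠ j)
    (hji : j ≠ i) {d : Fin n → C} {d₀ : C}
    {b : Fin l → C} {a : Fin r → C} {a₀ : C} {b' : Fin s → C} {o : Fin N → C}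
    {p q e pq pe t : ℤ} (h₁ : p + q = pq) (h₂ : pq + e = t) (h₃ : p + e = pe) (h₄ : pe + q = t)
    (A : Grafting c i d d₀ b) (A' : Grafting b (A.pos (Sum.inl ⟨j, hji⟩)) a a₀ o)
    (B : Grafting c j a a₀ b') (B' : Grafting b' (B.pos (Sum.inl ⟨i, hij⟩)) d d₀ o),
    Grafting.IsParallel hij hji A A' B B' →
    ∀ (x : obj c c₀ p) (y : obj d d₀ q) (z : obj a a₀ e),
    comp A' h₂ (comp A h₁ x y) z = koszulSign k (q * e) • comp B' h₄ (comp B h₃ x z) y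

/-- A morphism of graded coloured operads. -/
structure GradedOperad.Hom {k : Type u} [Field k] {C : Type v}
    (P : GradedOperad.{u, v, w₁} k C) (Q : GradedOperad.{u, v, w₂} k C) where
  app : ∀ {n : ℕ} (c : Fin n → C) (c₀ : C) (p : ℤ), P.obj c c₀ p →ₗ[k] Q.obj c c₀ p
  app_act : ∀ {n : ℕ} {c c' : Fin n → C} {c₀ : C} {p : ℤ} (σ : Equiv.Perm (Fin n))
    (h : ∀ s, c' s = c (σ s)) (x : P.obj c c₀ p),
    app c' c₀ p (P.act σ h x) = Q.act σ h (app c c₀ p x)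
  app_one : ∀ c : C, app _ c 0 (P.one c) = Q.one c
  app_comp : ∀ {m n l : ℕ} {c : Fin m → C} {c₀ : C} {i : Fin m} {d : Fin n → C} {d₀ : C}
    {b : Fin l → C} {p q r : ℤ} (A : Grafting c i d d₀ b) (hr : p + q = r)
    (x : P.obj c c₀ p) (y : P.obj d d₀ q),
    app b c₀ r (P.comp A hr x y) = Q.comp A hr (app c c₀ p x) (app d d₀ q y)

/-- A `C`-coloured dg-operad: a coloured operad in chain complexes (the differential has degree
`-1` and is a derivation for the partial compositions). -/
structure DGOperad (k : Type u) [Field k] (C : Type v) extends GradedOperad.{u, v, w} k C where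
  d : ∀ {n : ℕ} (c : Fin n → C) (c₀ : C) {p q : ℤ}, q + 1 = p → (obj c c₀ p →ₗ[k] obj c c₀ q)
  d_d : ∀ {n : ℕ} (c : Fin n → C) (c₀ : C) {p q r : ℤ} (h : q + 1 = p) (h' : r + 1 = q)
    (x : obj c c₀ p), d c c₀ h' (d c c₀ h x) = 0
  d_act : ∀ {n : ℕ} {c c' : Fin n → C} {c₀ : C} {p q : ℤ} (hd : q + 1 = p)
    (σ : Equiv.Perm (Fin n)) (h : ∀ s, c' s = c (σ s)) (x : obj c c₀ p),
    d c' c₀ hd (act σ h x) = act σ h (d c c₀ hd x)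
  d_one : ∀ (c : C) {q : ℤ} (h : q + 1 = 0), d _ c h (one c) = 0
  d_comp : ∀ {m n l : ℕ} {c : Fin m → C} {c₀ : C} {i : Fin m} {a : Fin n → C} {a₀ : C}
    {b : Fin l → C} {p p' q q' r r' : ℤ} (A : Grafting c i a a₀ b) (hr : p + q = r)
    (hp : p' + 1 = p) (hq : q' + 1 = q) (hr' : r' + 1 = r) (h₁ : p' + q = r') (h₂ : p + q' = r')
    (x : obj c c₀ p) (y : obj a a₀ q),
    d b c₀ hr' (comp A hr x y) =
      comp A h₁ (d c c₀ hp x) y + koszulSign k p • comp A h₂ x (d a a₀ hq y)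

namespace DGOperad

variable {k : Type u} [Field k] {C : Type v}

/-- A morphism of coloured dg-operads. -/
structure Hom (P : DGOperad.{u, v, w₁} k C) (Q : DGOperad.{u, v, w₂} k C)
    extends GradedOperad.Hom P.toGradedOperad Q.toGradedOperad where
  app_d : ∀ {n : ℕ} (c : Fin n → C) (c₀ : C) {p q : ℤ} (h : q + 1 = p) (x : P.obj c c₀ p),
    app c c₀ q (P.d c c₀ h x) = Q.d c c₀ h (app c c₀ p x)

/-- `f.comp g` is `f` after `g`. -/
def Hom.comp {P : DGOperad.{u, v, w₁} k C} {Q : DGOperad.{u, v, w₂} k C}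
    {R : DGOperad.{u, v, w₃} k C} (f : Hom Q R) (g : Hom P Q) : Hom P R where
  app c c₀ p := f.app c c₀ p ∘ₗ g.app c c₀ p
  app_act σ h x := by simp [g.app_act, f.app_act]
  app_one c := by simp [g.app_one, f.app_one]
  app_comp A hr x y := by simp [g.app_comp, f.app_comp]
  app_d c c₀ h x := by simp [g.app_d, f.app_d]

/-- Cycles of degree `p`. -/
def cycles (P : DGOperad.{u, v, w} k C) {n : ℕ} (c : Fin n → C) (c₀ : C) (p : ℤ) :
    Submodule k (P.obj c c₀ p) :=
  LinearMap.ker (P.d c c₀ (sub_add_cancel p 1))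

/-- Boundaries of degree `p`, as a subspace of the cycles. -/
def boundaries (P : DGOperad.{u, v, w} k C) {n : ℕ} (c : Fin n → C) (c₀ : C) (p : ℤ) :
    Submodule k (P.cycles c c₀ p) :=
  (LinearMap.range (P.d c c₀ (rfl : p + 1 = p + 1))).submoduleOf (P.cycles c c₀ p)

/-- The homology of the chain complex `P(c; c₀)` in degree `p`. -/
abbrev homology (P : DGOperad.{u, v, w} k C) {n : ℕ} (c : Fin n → C) (c₀ : C) (p : ℤ) : Type w :=
  P.cycles c c₀ p ⧸ P.boundaries c c₀ p

/-- The map induced by a morphism on cycles. -/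
def Hom.cyclesMap {P : DGOperad.{u, v, w₁} k C} {Q : DGOperad.{u, v, w₂} k C} (f : Hom P Q)
    {n : ℕ} (c : Fin n → C) (c₀ : C) (p : ℤ) : P.cycles c c₀ p →ₗ[k] Q.cycles c c₀ p :=
  (f.app c c₀ p).restrict (fun x hx => by
    have hx' : P.d c c₀ (sub_add_cancel p 1) x = 0 := hx
    change Q.d c c₀ (sub_add_cancel p 1) (f.app c c₀ p x) = 0
    rw [← f.app_d, hx', map_zero])

/-- The map induced by a morphism on homology. -/
def Hom.homologyMap {P : DGOperad.{u, v, w₁} k C} {Q : DGOperad.{u, v, w₂} k C} (f : Hom P Q)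
    {n : ℕ} (c : Fin n → C) (c₀ : C) (p : ℤ) : P.homology c c₀ p →ₗ[k] Q.homology c c₀ p :=
  (P.boundaries c c₀ p).mapQ (Q.boundaries c c₀ p) (f.cyclesMap c c₀ p) (by
    rintro ⟨x, hx⟩ ⟨y, hy⟩
    have hy' : P.d c c₀ rfl y = x := hy
    exact ⟨f.app c c₀ (p + 1) y, by
      change Q.d c c₀ rfl (f.app c c₀ (p + 1) y) = f.app c c₀ p x
      rw [← f.app_d, hy']⟩)

/-- The morphism induces isomorphisms on homology. -/
def Hom.IsHomologyIso {P : DGOperad.{u, v, w₁} k C} {Q : DGOperad.{u, v, w₂} k C} (f : Hom P Q) :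
    Prop :=
  ∀ {n : ℕ} (c : Fin n → C) (c₀ : C) (p : ℤ), Function.Bijective (f.homologyMap c c₀ p)

/-- The morphism is surjective in every arity, colouring and degree. -/
def Hom.IsSurjective {P : DGOperad.{u, v, w₁} k C} {Q : DGOperad.{u, v, w₂} k C} (f : Hom P Q) :
    Prop :=
  ∀ {n : ℕ} (c : Fin n → C) (c₀ : C) (p : ℤ), Function.Surjective (f.app c c₀ p)

end DGOperad

namespace OperadPresentation

variable {k : Type u} [Field k] {C : Type v}

/-- Formal operadic expressions in a family `X` of coloured graded generators. -/
inductive Term (k : Type u) [Field k] {C : Type v}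
    (X : {n : ℕ} → (Fin n → C) → C → ℤ → Type w) :
    {n : ℕ} → (Fin n → C) → C → ℤ → Type (max u v w)
  | gen {n : ℕ} {c : Fin n → C} {c₀ : C} {p : ℤ} : X c c₀ p → Term k X c c₀ p
  | zero {n : ℕ} {c : Fin n → C} {c₀ : C} {p : ℤ} : Term k X c c₀ p
  | add {n : ℕ} {c : Fin n → C} {c₀ : C} {p : ℤ} :
      Term k X c c₀ p → Term k X c c₀ p → Term k X c c₀ p
  | smul {n : ℕ} {c : Fin n → C} {c₀ : C} {p : ℤ} : k → Term k X c c₀ p → Term k X c c₀ p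
  | act {n : ℕ} {c c' : Fin n → C} {c₀ : C} {p : ℤ} (σ : Equiv.Perm (Fin n))
      (h : ∀ s, c' s = c (σ s)) : Term k X c c₀ p → Term k X c' c₀ p
  | one (c : C) : Term k X (fun _ : Fin 1 => c) c 0
  | comp {m n l : ℕ} {c : Fin m → C} {c₀ : C} {i : Fin m} {d : Fin n → C} {d₀ : C}
      {b : Fin l → C} {p q r : ℤ} (A : Grafting c i d d₀ b) (hr : p + q = r) :
      Term k X c c₀ p → Term k X d d₀ q → Term k X b c₀ r

/-- The smallest congruence on formal expressions that contains the relations `R` and the axioms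
of a graded operad. -/
inductive Rel {X : {n : ℕ} → (Fin n → C) → C → ℤ → Type w}
    (R : ∀ {n : ℕ} {c : Fin n → C} {c₀ : C} {p : ℤ}, Term k X c c₀ p → Term k X c c₀ p → Prop) :
    ∀ {n : ℕ} {c : Fin n → C} {c₀ : C} {p : ℤ}, Term k X c c₀ p → Term k X c c₀ p → Prop
  | of {n : ℕ} {c : Fin n → C} {c₀ : C} {p : ℤ} {x y : Term k X c c₀ p} : R x y → Rel R x y
  | refl {n : ℕ} {c : Fin n → C} {c₀ : C} {p : ℤ} (x : Term k X c c₀ p) : Rel R x x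
  | symm {n : ℕ} {c : Fin n → C} {c₀ : C} {p : ℤ} {x y : Term k X c c₀ p} :
      Rel R x y → Rel R y x
  | trans {n : ℕ} {c : Fin n → C} {c₀ : C} {p : ℤ} {x y z : Term k X c c₀ p} :
      Rel R x y → Rel R y z → Rel R x z
  -- congruence
  | add_congr {n : ℕ} {c : Fin n → C} {c₀ : C} {p : ℤ} {x x' y y' : Term k X c c₀ p} :
      Rel R x x' → Rel R y y' → Rel R (x.add y) (x'.add y')
  | smul_congr {n : ℕ} {c : Fin n → C} {c₀ : C} {p : ℤ} (a : k) {x x' : Term k X c c₀ p} :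
      Rel R x x' → Rel R (x.smul a) (x'.smul a)
  | act_congr {n : ℕ} {c c' : Fin n → C} {c₀ : C} {p : ℤ} (σ : Equiv.Perm (Fin n))
      (h : ∀ s, c' s = c (σ s)) {x x' : Term k X c c₀ p} :
      Rel R x x' → Rel R (x.act σ h) (x'.act σ h)
  | comp_congr {m n l : ℕ} {c : Fin m → C} {c₀ : C} {i : Fin m} {d : Fin n → C} {d₀ : C}
      {b : Fin l → C} {p q r : ℤ} (A : Grafting c i d d₀ b) (hr : p + q = r)
      {x x' : Term k X c c₀ p} {y y' : Term k X d d₀ q} :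
      Rel R x x' → Rel R y y' → Rel R (Term.comp A hr x y) (Term.comp A hr x' y')
  -- vector space axioms
  | add_comm {n : ℕ} {c : Fin n → C} {c₀ : C} {p : ℤ} (x y : Term k X c c₀ p) :
      Rel R (x.add y) (y.add x)
  | add_assoc {n : ℕ} {c : Fin n → C} {c₀ : C} {p : ℤ} (x y z : Term k X c c₀ p) :
      Rel R ((x.add y).add z) (x.add (y.add z))
  | zero_add {n : ℕ} {c : Fin n → C} {c₀ : C} {p : ℤ} (x : Term k X c c₀ p) :
      Rel R (Term.zero.add x) x
  | smul_add {n : ℕ} {c : Fin n → C} {c₀ : C} {p : ℤ} (a : k) (x y : Term k X c c₀ p) :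
      Rel R ((x.add y).smul a) ((x.smul a).add (y.smul a))
  | add_smul {n : ℕ} {c : Fin n → C} {c₀ : C} {p : ℤ} (a a' : k) (x : Term k X c c₀ p) :
      Rel R (x.smul (a + a')) ((x.smul a).add (x.smul a'))
  | mul_smul {n : ℕ} {c : Fin n → C} {c₀ : C} {p : ℤ} (a a' : k) (x : Term k X c c₀ p) :
      Rel R (x.smul (a * a')) ((x.smul a').smul a)
  | one_smul {n : ℕ} {c : Fin n → C} {c₀ : C} {p : ℤ} (x : Term k X c c₀ p) :
      Rel R (x.smul 1) x
  | zero_smul {n : ℕ} {c : Fin n → C} {c₀ : C} {p : ℤ} (x : Term k X c c₀ p) :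
      Rel R (x.smul 0) Term.zero
  -- linearity of the operations
  | act_add {n : ℕ} {c c' : Fin n → C} {c₀ : C} {p : ℤ} (σ : Equiv.Perm (Fin n))
      (h : ∀ s, c' s = c (σ s)) (x y : Term k X c c₀ p) :
      Rel R ((x.add y).act σ h) ((x.act σ h).add (y.act σ h))
  | act_smul {n : ℕ} {c c' : Fin n → C} {c₀ : C} {p : ℤ} (σ : Equiv.Perm (Fin n))
      (h : ∀ s, c' s = c (σ s)) (a : k) (x : Term k X c c₀ p) :
      Rel R ((x.smul a).act σ h) ((x.act σ h).smul a)
  | add_comp {m n l : ℕ} {c : Fin m → C} {c₀ : C} {i : Fin m} {d : Fin n → C} {d₀ : C}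
      {b : Fin l → C} {p q r : ℤ} (A : Grafting c i d d₀ b) (hr : p + q = r)
      (x x' : Term k X c c₀ p) (y : Term k X d d₀ q) :
      Rel R (Term.comp A hr (x.add x') y) ((Term.comp A hr x y).add (Term.comp A hr x' y))
  | smul_comp {m n l : ℕ} {c : Fin m → C} {c₀ : C} {i : Fin m} {d : Fin n → C} {d₀ : C}
      {b : Fin l → C} {p q r : ℤ} (A : Grafting c i d d₀ b) (hr : p + q = r) (a : k)
      (x : Term k X c c₀ p) (y : Term k X d d₀ q) :
      Rel R (Term.comp A hr (x.smul a) y) ((Term.comp A hr x y).smul a)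
  | comp_add {m n l : ℕ} {c : Fin m → C} {c₀ : C} {i : Fin m} {d : Fin n → C} {d₀ : C}
      {b : Fin l → C} {p q r : ℤ} (A : Grafting c i d d₀ b) (hr : p + q = r)
      (x : Term k X c c₀ p) (y y' : Term k X d d₀ q) :
      Rel R (Term.comp A hr x (y.add y')) ((Term.comp A hr x y).add (Term.comp A hr x y'))
  | comp_smul {m n l : ℕ} {c : Fin m → C} {c₀ : C} {i : Fin m} {d : Fin n → C} {d₀ : C}
      {b : Fin l → C} {p q r : ℤ} (A : Grafting c i d d₀ b) (hr : p + q = r) (a : k)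
      (x : Term k X c c₀ p) (y : Term k X d d₀ q) :
      Rel R (Term.comp A hr x (y.smul a)) ((Term.comp A hr x y).smul a)
  -- operad axioms
  | act_refl {n : ℕ} {c : Fin n → C} {c₀ : C} {p : ℤ}
      (h : ∀ s, c s = c ((1 : Equiv.Perm (Fin n)) s)) (x : Term k X c c₀ p) : Rel R (x.act 1 h) x
  | act_act {n : ℕ} {c c' c'' : Fin n → C} {c₀ : C} {p : ℤ} (σ τ : Equiv.Perm (Fin n))
      (h : ∀ s, c' s = c (σ s)) (h' : ∀ s, c'' s = c' (τ s)) (h'' : ∀ s, c'' s = c ((σ * τ) s))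
      (x : Term k X c c₀ p) : Rel R ((x.act σ h).act τ h') (x.act (σ * τ) h'')
  | act_comp {m n l : ℕ} {c : Fin m → C} {c₀ : C} {i : Fin m} {d : Fin n → C} {d₀ : C}
      {b b' : Fin l → C} {p q r : ℤ} (hr : p + q = r) (σ : Equiv.Perm (Fin l))
      (h : ∀ s, b' s = b (σ s)) (A : Grafting c i d d₀ b) (B : Grafting c i d d₀ b')
      (hAB : A.IsPermuted σ B) (x : Term k X c c₀ p) (y : Term k X d d₀ q) :
      Rel R ((Term.comp A hr x y).act σ h) (Term.comp B hr x y)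
  | comp_act_left {m n l : ℕ} {c c' : Fin m → C} {c₀ : C} {i : Fin m} {d : Fin n → C} {d₀ : C}
      {b : Fin l → C} {p q r : ℤ} (hr : p + q = r) (σ : Equiv.Perm (Fin m))
      (h : ∀ s, c' s = c (σ s)) (A : Grafting c' i d d₀ b) (B : Grafting c (σ i) d d₀ b)
      (hAB : A.IsPermutedLeft σ B) (x : Term k X c c₀ p) (y : Term k X d d₀ q) :
      Rel R (Term.comp A hr (x.act σ h) y) (Term.comp B hr x y)
  | comp_act_right {m n l : ℕ} {c : Fin m → C} {c₀ : C} {i : Fin m} {d d' : Fin n → C} {d₀ : C}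
      {b : Fin l → C} {p q r : ℤ} (hr : p + q = r) (τ : Equiv.Perm (Fin n))
      (h : ∀ s, d' s = d (τ s)) (A : Grafting c i d' d₀ b) (B : Grafting c i d d₀ b)
      (hAB : A.IsPermutedRight τ B) (x : Term k X c c₀ p) (y : Term k X d d₀ q) :
      Rel R (Term.comp A hr x (y.act τ h)) (Term.comp B hr x y)
  | comp_one {m : ℕ} {c b : Fin m → C} {c₀ c₁ : C} {i : Fin m} {p : ℤ} (hp : p + 0 = p)
      (A : Grafting c i (fun _ : Fin 1 => c₁) c₁ b) (σ : Equiv.Perm (Fin m))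
      (h : ∀ s, b s = c (σ s)) (hA : ∀ s, σ (A.pos (Sum.inl s)) = s.1)
      (hA' : σ (A.pos (Sum.inr 0)) = i) (x : Term k X c c₀ p) :
      Rel R (Term.comp A hp x (Term.one c₁)) (x.act σ h)
  | one_comp {n : ℕ} {d b : Fin n → C} {c₀ : C} {i : Fin 1} {q : ℤ} (hq : 0 + q = q)
      (A : Grafting (fun _ : Fin 1 => c₀) i d c₀ b) (σ : Equiv.Perm (Fin n))
      (h : ∀ s, b s = d (σ s)) (hA : ∀ t, σ (A.pos (Sum.inr t)) = t) (y : Term k X d c₀ q) :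
      Rel R (Term.comp A hq (Term.one c₀) y) (y.act σ h)
  | assoc_seq {m n l r s N : ℕ} {c : Fin m → C} {c₀ : C} {i : Fin m} {d : Fin n → C} {d₀ : C}
      {b : Fin l → C} {j : Fin n} {a : Fin r → C} {a₀ : C} {b' : Fin s → C} {o : Fin N → C}
      {p q e pq qe t : ℤ} (h₁ : p + q = pq) (h₂ : pq + e = t) (h₃ : q + e = qe) (h₄ : p + qe = t)
      (A : Grafting c i d d₀ b) (A' : Grafting b (A.pos (Sum.inr j)) a a₀ o)
      (B : Grafting d j a a₀ b') (B' : Grafting c i b' d₀ o)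
      (hA : Grafting.IsSequential A A' B B')
      (x : Term k X c c₀ p) (y : Term k X d d₀ q) (z : Term k X a a₀ e) :
      Rel R (Term.comp A' h₂ (Term.comp A h₁ x y) z) (Term.comp B' h₄ x (Term.comp B h₃ y z))
  | assoc_par {m n l r s N : ℕ} {c : Fin m → C} {c₀ : C} {i j : Fin m} (hij : i ≠ j)
      (hji : j ≠ i) {d : Fin n → C} {d₀ : C}
      {b : Fin l → C} {a : Fin r → C} {a₀ : C} {b' : Fin s → C} {o : Fin N → C}
      {p q e pq pe t : ℤ} (h₁ : p + q = pq) (h₂ : pq + e = t) (h₃ : p + e = pe) (h₄ : pe + q = t)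
      (A : Grafting c i d d₀ b) (A' : Grafting b (A.pos (Sum.inl ⟨j, hji⟩)) a a₀ o)
      (B : Grafting c j a a₀ b') (B' : Grafting b' (B.pos (Sum.inl ⟨i, hij⟩)) d d₀ o)
      (hA : Grafting.IsParallel hij hji A A' B B')
      (x : Term k X c c₀ p) (y : Term k X d d₀ q) (z : Term k X a a₀ e) :
      Rel R (Term.comp A' h₂ (Term.comp A h₁ x y) z)
        ((Term.comp B' h₄ (Term.comp B h₃ x z) y).smul (koszulSign k (q * e)))

variable {X : {n : ℕ} → (Fin n → C) → C → ℤ → Type w}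
  (R : ∀ {n : ℕ} {c : Fin n → C} {c₀ : C} {p : ℤ}, Term k X c c₀ p → Term k X c c₀ p → Prop)

/-- Congruence of formal expressions as a setoid. -/
def setoid {n : ℕ} (c : Fin n → C) (c₀ : C) (p : ℤ) : Setoid (Term k X c c₀ p) where
  r := Rel R
  iseqv := ⟨Rel.refl, Rel.symm, Rel.trans⟩

/-- Formal expressions modulo the relations. -/
def Carrier {n : ℕ} (c : Fin n → C) (c₀ : C) (p : ℤ) : Type (max u v w) :=
  Quotient (setoid R c c₀ p)

/-- The class of a formal expression. -/
def mk {n : ℕ} {c : Fin n → C} {c₀ : C} {p : ℤ} (x : Term k X c c₀ p) : Carrier R c c₀ p :=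
  Quotient.mk (setoid R c c₀ p) x

theorem mk_eq {n : ℕ} {c : Fin n → C} {c₀ : C} {p : ℤ} {x y : Term k X c c₀ p}
    (h : Rel R x y) : mk R x = mk R y :=
  Quotient.sound (s := setoid R c c₀ p) h

instance instZero {n : ℕ} (c : Fin n → C) (c₀ : C) (p : ℤ) : Zero (Carrier R c c₀ p) :=
  ⟨mk R Term.zero⟩

instance instAdd {n : ℕ} (c : Fin n → C) (c₀ : C) (p : ℤ) : Add (Carrier R c c₀ p) :=
  ⟨Quotient.map₂ Term.add (fun _ _ h _ _ h' => Rel.add_congr h h')⟩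

instance instNeg {n : ℕ} (c : Fin n → C) (c₀ : C) (p : ℤ) : Neg (Carrier R c c₀ p) :=
  ⟨Quotient.map (Term.smul (-1)) (fun _ _ h => Rel.smul_congr _ h)⟩

instance addCommGroup {n : ℕ} (c : Fin n → C) (c₀ : C) (p : ℤ) :
    AddCommGroup (Carrier R c c₀ p) where
  add_assoc := by
    rintro ⟨x⟩ ⟨y⟩ ⟨z⟩
    exact mk_eq R (Rel.add_assoc x y z)
  zero_add := by
    rintro ⟨x⟩
    exact mk_eq R (Rel.zero_add x)
  add_zero := by
    rintro ⟨x⟩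
    exact mk_eq R ((Rel.add_comm _ _).trans (Rel.zero_add x))
  add_comm := by
    rintro ⟨x⟩ ⟨y⟩
    exact mk_eq R (Rel.add_comm x y)
  neg_add_cancel := by
    rintro ⟨x⟩
    refine mk_eq R (Rel.trans (Rel.add_congr (Rel.refl _) (Rel.one_smul x).symm) ?_)
    refine (Rel.add_smul (-1) 1 x).symm.trans ?_
    rw [neg_add_cancel]
    exact Rel.zero_smul x
  nsmul := nsmulRec
  zsmul := zsmulRec

instance module {n : ℕ} (c : Fin n → C) (c₀ : C) (p : ℤ) : Module k (Carrier R c c₀ p) where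
  smul a := Quotient.map (Term.smul a) (fun _ _ h => Rel.smul_congr a h)
  one_smul := by
    rintro ⟨x⟩
    exact mk_eq R (Rel.one_smul x)
  mul_smul := by
    rintro a b ⟨x⟩
    exact mk_eq R (Rel.mul_smul a b x)
  smul_zero a := by
    refine mk_eq R (Rel.trans (Rel.smul_congr a (Rel.zero_smul Term.zero).symm) ?_)
    refine (Rel.mul_smul a 0 _).symm.trans ?_
    rw [mul_zero]
    exact Rel.zero_smul _
  smul_add := by
    rintro a ⟨x⟩ ⟨y⟩
    exact mk_eq R (Rel.smul_add a x y)
  add_smul := by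
    rintro a b ⟨x⟩
    exact mk_eq R (Rel.add_smul a b x)
  zero_smul := by
    rintro ⟨x⟩
    exact mk_eq R (Rel.zero_smul x)

/-- The graded coloured operad with generators `X` and relations `R`. -/
def operad : GradedOperad.{u, v, max u v w} k C where
  obj c c₀ p := Carrier R c c₀ p
  act σ h :=
    { toFun := Quotient.map (Term.act σ h) (fun _ _ hx => Rel.act_congr σ h hx)
      map_add' := by
        rintro ⟨x⟩ ⟨y⟩
        exact mk_eq R (Rel.act_add σ h x y)
      map_smul' := by
        rintro a ⟨x⟩
        exact mk_eq R (Rel.act_smul σ h a x) }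
  act_refl := by
    rintro n c c₀ p h ⟨x⟩
    exact mk_eq R (Rel.act_refl h x)
  act_act := by
    rintro n c c' c'' c₀ p σ τ h h' h'' ⟨x⟩
    exact mk_eq R (Rel.act_act σ τ h h' h'' x)
  one c := mk R (Term.one c)
  comp A hr := LinearMap.mk₂ k
    (Quotient.map₂ (Term.comp A hr) (fun _ _ hx _ _ hy => Rel.comp_congr A hr hx hy))
    (by
      rintro ⟨x⟩ ⟨x'⟩ ⟨y⟩
      exact mk_eq R (Rel.add_comp A hr x x' y))
    (by
      rintro a ⟨x⟩ ⟨y⟩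
      exact mk_eq R (Rel.smul_comp A hr a x y))
    (by
      rintro ⟨x⟩ ⟨y⟩ ⟨y'⟩
      exact mk_eq R (Rel.comp_add A hr x y y'))
    (by
      rintro a ⟨x⟩ ⟨y⟩
      exact mk_eq R (Rel.comp_smul A hr a x y))
  act_comp := by
    rintro m n l c c₀ i d d₀ b b' p q r hr σ h A B hAB ⟨x⟩ ⟨y⟩
    exact mk_eq R (Rel.act_comp hr σ h A B hAB x y)
  comp_act_left := by
    rintro m n l c c' c₀ i d d₀ b p q r hr σ h A B hAB ⟨x⟩ ⟨y⟩
    exact mk_eq R (Rel.comp_act_left hr σ h A B hAB x y)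
  comp_act_right := by
    rintro m n l c c₀ i d d' d₀ b p q r hr τ h A B hAB ⟨x⟩ ⟨y⟩
    exact mk_eq R (Rel.comp_act_right hr τ h A B hAB x y)
  comp_one := by
    rintro m c b c₀ c₁ i p hp A σ h hA hA' ⟨x⟩
    exact mk_eq R (Rel.comp_one hp A σ h hA hA' x)
  one_comp := by
    rintro n d b c₀ i q hq A σ h hA ⟨y⟩
    exact mk_eq R (Rel.one_comp hq A σ h hA y)
  assoc_seq := by
    rintro m n l r s N c c₀ i d d₀ b j a a₀ b' o p q e pq qe t h₁ h₂ h₃ h₄ A A' B B' hA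
      ⟨x⟩ ⟨y⟩ ⟨z⟩
    exact mk_eq R (Rel.assoc_seq h₁ h₂ h₃ h₄ A A' B B' hA x y z)
  assoc_par := by
    rintro m n l r s N c c₀ i j hij hji d d₀ b a a₀ b' o p q e pq pe t h₁ h₂ h₃ h₄ A A' B B' hA
      ⟨x⟩ ⟨y⟩ ⟨z⟩
    exact mk_eq R (Rel.assoc_par hij hji h₁ h₂ h₃ h₄ A A' B B' hA x y z)

end OperadPresentation

namespace GradedOperad

open OperadPresentation

variable {k : Type u} [Field k] {C : Type v}

/-- The relations of the free operad on a collection: the generators are inserted linearly and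
equivariantly. -/
inductive FreeRel (E : GradedCollection.{u, v, w} k C) :
    ∀ {n : ℕ} {c : Fin n → C} {c₀ : C} {p : ℤ},
    Term k E.obj c c₀ p → Term k E.obj c c₀ p → Prop
  | add {n : ℕ} {c : Fin n → C} {c₀ : C} {p : ℤ} (x y : E.obj c c₀ p) :
      FreeRel E (Term.gen (x + y)) ((Term.gen x).add (Term.gen y))
  | smul {n : ℕ} {c : Fin n → C} {c₀ : C} {p : ℤ} (a : k) (x : E.obj c c₀ p) :
      FreeRel E (Term.gen (a • x)) ((Term.gen x).smul a)
  | act {n : ℕ} {c c' : Fin n → C} {c₀ : C} {p : ℤ} (σ : Equiv.Perm (Fin n))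
      (h : ∀ s, c' s = c (σ s)) (x : E.obj c c₀ p) :
      FreeRel E (Term.gen (E.act σ h x)) ((Term.gen x).act σ h)

/-- The free graded operad `Γ(E)` on a collection `E`. -/
def free (E : GradedCollection.{u, v, w} k C) : GradedOperad.{u, v, max u v w} k C :=
  OperadPresentation.operad (FreeRel E)

/-- The inclusion of the generators `E → Γ(E)`. -/
def freeOf (E : GradedCollection.{u, v, w} k C) {n : ℕ} {c : Fin n → C} {c₀ : C} {p : ℤ}
    (x : E.obj c c₀ p) : (free E).obj c c₀ p :=
  OperadPresentation.mk (FreeRel E) (Term.gen x)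

/-- The relations of the free product: all relations that hold in `P` and all that hold
in `Q`. -/
inductive CoprodRel (P : GradedOperad.{u, v, w₁} k C) (Q : GradedOperad.{u, v, w₂} k C) :
    ∀ {n : ℕ} {c : Fin n → C} {c₀ : C} {p : ℤ},
    Term k (fun c c₀ p => P.obj c c₀ p ⊕ Q.obj c c₀ p) c c₀ p →
    Term k (fun c c₀ p => P.obj c c₀ p ⊕ Q.obj c c₀ p) c c₀ p → Prop
  | inl_add {n : ℕ} {c : Fin n → C} {c₀ : C} {p : ℤ} (x y : P.obj c c₀ p) :
      CoprodRel P Q (Term.gen (Sum.inl (x + y)))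
        ((Term.gen (Sum.inl x)).add (Term.gen (Sum.inl y)))
  | inl_smul {n : ℕ} {c : Fin n → C} {c₀ : C} {p : ℤ} (a : k) (x : P.obj c c₀ p) :
      CoprodRel P Q (Term.gen (Sum.inl (a • x))) ((Term.gen (Sum.inl x)).smul a)
  | inl_act {n : ℕ} {c c' : Fin n → C} {c₀ : C} {p : ℤ} (σ : Equiv.Perm (Fin n))
      (h : ∀ s, c' s = c (σ s)) (x : P.obj c c₀ p) :
      CoprodRel P Q (Term.gen (Sum.inl (P.act σ h x))) ((Term.gen (Sum.inl x)).act σ h)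
  | inl_one (c : C) : CoprodRel P Q (Term.gen (Sum.inl (P.one c))) (Term.one c)
  | inl_comp {m n l : ℕ} {c : Fin m → C} {c₀ : C} {i : Fin m} {d : Fin n → C} {d₀ : C}
      {b : Fin l → C} {p q r : ℤ} (A : Grafting c i d d₀ b) (hr : p + q = r)
      (x : P.obj c c₀ p) (y : P.obj d d₀ q) :
      CoprodRel P Q (Term.gen (Sum.inl (P.comp A hr x y)))
        (Term.comp A hr (Term.gen (Sum.inl x)) (Term.gen (Sum.inl y)))
  | inr_add {n : ℕ} {c : Fin n → C} {c₀ : C} {p : ℤ} (x y : Q.obj c c₀ p) :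
      CoprodRel P Q (Term.gen (Sum.inr (x + y)))
        ((Term.gen (Sum.inr x)).add (Term.gen (Sum.inr y)))
  | inr_smul {n : ℕ} {c : Fin n → C} {c₀ : C} {p : ℤ} (a : k) (x : Q.obj c c₀ p) :
      CoprodRel P Q (Term.gen (Sum.inr (a • x))) ((Term.gen (Sum.inr x)).smul a)
  | inr_act {n : ℕ} {c c' : Fin n → C} {c₀ : C} {p : ℤ} (σ : Equiv.Perm (Fin n))
      (h : ∀ s, c' s = c (σ s)) (x : Q.obj c c₀ p) :
      CoprodRel P Q (Term.gen (Sum.inr (Q.act σ h x))) ((Term.gen (Sum.inr x)).act σ h)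
  | inr_one (c : C) : CoprodRel P Q (Term.gen (Sum.inr (Q.one c))) (Term.one c)
  | inr_comp {m n l : ℕ} {c : Fin m → C} {c₀ : C} {i : Fin m} {d : Fin n → C} {d₀ : C}
      {b : Fin l → C} {p q r : ℤ} (A : Grafting c i d d₀ b) (hr : p + q = r)
      (x : Q.obj c c₀ p) (y : Q.obj d d₀ q) :
      CoprodRel P Q (Term.gen (Sum.inr (Q.comp A hr x y)))
        (Term.comp A hr (Term.gen (Sum.inr x)) (Term.gen (Sum.inr y)))

/-- The free product (coproduct) `P * Q` of graded operads. -/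
def coprod (P : GradedOperad.{u, v, w₁} k C) (Q : GradedOperad.{u, v, w₂} k C) :
    GradedOperad.{u, v, max u v w₁ w₂} k C :=
  OperadPresentation.operad (CoprodRel P Q)

/-- The canonical map `P → P * Q`. -/
def coprodInl (P : GradedOperad.{u, v, w₁} k C) (Q : GradedOperad.{u, v, w₂} k C) {n : ℕ}
    {c : Fin n → C} {c₀ : C} {p : ℤ} (x : P.obj c c₀ p) : (coprod P Q).obj c c₀ p :=
  OperadPresentation.mk (CoprodRel P Q) (Term.gen (Sum.inl x))

/-- The canonical map `Q → P * Q`. -/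
def coprodInr (P : GradedOperad.{u, v, w₁} k C) (Q : GradedOperad.{u, v, w₂} k C) {n : ℕ}
    {c : Fin n → C} {c₀ : C} {p : ℤ} (x : Q.obj c c₀ p) : (coprod P Q).obj c c₀ p :=
  OperadPresentation.mk (CoprodRel P Q) (Term.gen (Sum.inr x))

/-- A suboperad of a graded operad. -/
structure Suboperad (P : GradedOperad.{u, v, w} k C) where
  carrier : ∀ {n : ℕ} (c : Fin n → C) (c₀ : C) (p : ℤ), Submodule k (P.obj c c₀ p)
  act_mem : ∀ {n : ℕ} {c c' : Fin n → C} {c₀ : C} {p : ℤ} (σ : Equiv.Perm (Fin n))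
    (h : ∀ s, c' s = c (σ s)) (x : P.obj c c₀ p), x ∈ carrier c c₀ p →
    P.act σ h x ∈ carrier c' c₀ p
  one_mem : ∀ c : C, P.one c ∈ carrier (fun _ : Fin 1 => c) c 0
  comp_mem : ∀ {m n l : ℕ} {c : Fin m → C} {c₀ : C} {i : Fin m} {d : Fin n → C} {d₀ : C}
    {b : Fin l → C} {p q r : ℤ} (A : Grafting c i d d₀ b) (hr : p + q = r)
    (x : P.obj c c₀ p) (y : P.obj d d₀ q), x ∈ carrier c c₀ p → y ∈ carrier d d₀ q →
    P.comp A hr x y ∈ carrier b c₀ r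

/-- The elements of the suboperad generated by a family `G` of sets of elements. -/
def generated (P : GradedOperad.{u, v, w} k C)
    (G : ∀ {n : ℕ} (c : Fin n → C) (c₀ : C) (p : ℤ), Set (P.obj c c₀ p))
    {n : ℕ} (c : Fin n → C) (c₀ : C) (p : ℤ) : Set (P.obj c c₀ p) :=
  {x | ∀ T : Suboperad P,
    (∀ {m : ℕ} (b : Fin m → C) (b₀ : C) (q : ℤ), G b b₀ q ⊆ T.carrier b b₀ q) →
    x ∈ T.carrier c c₀ p}

end GradedOperad

/-- A subcollection of a graded collection. -/
structure GradedCollection.Sub {k : Type u} [Field k] {C : Type v}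
    (E : GradedCollection.{u, v, w} k C) where
  carrier : ∀ {n : ℕ} (c : Fin n → C) (c₀ : C) (p : ℤ), Submodule k (E.obj c c₀ p)
  act_mem : ∀ {n : ℕ} {c c' : Fin n → C} {c₀ : C} {p : ℤ} (σ : Equiv.Perm (Fin n))
    (h : ∀ s, c' s = c (σ s)) (x : E.obj c c₀ p), x ∈ carrier c c₀ p →
    E.act σ h x ∈ carrier c' c₀ p

namespace DGOperad

open GradedOperad

variable {k : Type u} [Field k] {C : Type v}

/-- `ι : S → Q` is an elemental cofibration: for some collection `E = ⨁ₙ Eₙ`, the underlying graded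
operad of `Q` is `S * Γ(E)` (identified by the isomorphism `φ`), `ι` is the canonical inclusion,
and `∂ Eₙ` lies in `S * Γ(E)_{<n}`, the suboperad generated by `S` and the `E_j` with `j < n`. -/
def Hom.IsElementalCofibration {S : DGOperad.{u, v, w₁} k C} {Q : DGOperad.{u, v, w₂} k C}
    (ι : Hom S Q) : Prop :=
  ∃ (E : GradedCollection.{u, v, w₂} k C) (Efil : ℕ → E.Sub)
    (φ : GradedOperad.Hom (coprod S.toGradedOperad (free E)) Q.toGradedOperad),
    (∀ {n : ℕ} (c : Fin n → C) (c₀ : C) (p : ℤ),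
      DirectSum.IsInternal (fun N : ℕ => (Efil N).carrier c c₀ p)) ∧
    (∀ {n : ℕ} (c : Fin n → C) (c₀ : C) (p : ℤ), Function.Bijective (φ.app c c₀ p)) ∧
    (∀ {n : ℕ} (c : Fin n → C) (c₀ : C) (p : ℤ) (x : S.obj c c₀ p),
      φ.app c c₀ p (coprodInl _ _ x) = ι.app c c₀ p x) ∧
    ∀ (N : ℕ) {n : ℕ} (c : Fin n → C) (c₀ : C) {p q : ℤ} (hd : q + 1 = p) (x : E.obj c c₀ p),
      x ∈ (Efil N).carrier c c₀ p →
      Q.d c c₀ hd (φ.app c c₀ p (coprodInr _ _ (freeOf E x))) ∈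
        Q.toGradedOperad.generated (fun b b₀ r =>
          Set.range (ι.app b b₀ r) ∪
          {y | ∃ j < N, ∃ e ∈ (Efil j).carrier b b₀ r,
            y = φ.app b b₀ r (coprodInr _ _ (freeOf E e))}) c c₀ q

end DGOperad

/-! The graded operad underlying `Q` is `S * Γ(E)`. By its universal property, a graded morphism `Q
→ X` that restricts to `f` on `S` is the same as an equivariant linear map `α : E → X`; call it `Φ
α`. It remains to choose `α` so that `Φ α` commutes with the differentials and lies over `g`. Both
conditions cut out suboperads of `Q` (`commLocus`, `Hom.eqLocus`), so they need checking only on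
`S`, where they come from `f` and the square, and on each `E_N`.

The map `α` is built by induction on `N`. For `e ∈ E_N` the differential `∂e` lies in the suboperad
generated by `S` and the earlier `E_j`, where `Φ α` is already determined, commutes with `∂`, and
lies over `g`. Hence `z = Φ α (∂e)` is a cycle over `∂(g e)`, and `α e` must solve `p(α e) = g e`,
`∂(α e) = z`. This is solvable because `p` is surjective with acyclic kernel
(`Hom.exists_d_eq_of_app_eq_zero`), and linearly in `e` because vector spaces are projective
(`Hom.exists_linear_lift`). A linear solution need not be equivariant. Both equations are
equivariant, so averaging over the symmetric groups repairs this (`average_eq`); characteristic zero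
enters only there.

Passing from `N` to `N + 1` leaves `α` unchanged on the earlier summands, so the stages glue over `E
= ⨁ E_N` to a single map (`exists_liftsBelow`). -/

/-- An equivariant, degree-preserving linear map of graded collections. -/
structure GradedCollection.Hom {k : Type u} [Field k] {C : Type v}
    (E : GradedCollection.{u, v, w₁} k C) (F : GradedCollection.{u, v, w₂} k C) where
  app : ∀ {n : ℕ} (c : Fin n → C) (c₀ : C) (p : ℤ), E.obj c c₀ p →ₗ[k] F.obj c c₀ p
  app_act : ∀ {n : ℕ} {c c' : Fin n → C} {c₀ : C} {p : ℤ} (σ : Equiv.Perm (Fin n))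
    (h : ∀ s, c' s = c (σ s)) (x : E.obj c c₀ p),
    app c' c₀ p (E.act σ h x) = F.act σ h (app c c₀ p x)

/-! ### Evaluation of formal expressions and the universal property of presented operads. -/

namespace OperadPresentation

variable {k : Type u} [Field k] {C : Type v}
  {X : {n : ℕ} → (Fin n → C) → C → ℤ → Type w}
  (P : GradedOperad.{u, v, w₁} k C)
  (φ : ∀ {n : ℕ} {c : Fin n → C} {c₀ : C} {p : ℤ}, X c c₀ p → P.obj c c₀ p)

/-- The value of a formal expression in an operad, given the values of the generators. -/
def Term.eval : ∀ {n : ℕ} {c : Fin n → C} {c₀ : C} {p : ℤ}, Term k X c c₀ p → P.obj c c₀ p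
  | _, _, _, _, .gen x => φ x
  | _, _, _, _, .zero => 0
  | _, _, _, _, .add x y => x.eval + y.eval
  | _, _, _, _, .smul a x => a • x.eval
  | _, _, _, _, .act σ h x => P.act σ h x.eval
  | _, _, _, _, .one c => P.one c
  | _, _, _, _, .comp A hr x y => P.comp A hr x.eval y.eval

variable {R : ∀ {n : ℕ} {c : Fin n → C} {c₀ : C} {p : ℤ}, Term k X c c₀ p → Term k X c c₀ p → Prop}

/-- Apart from `of`, each constructor of `Rel` is an equivalence or congruence rule, or an axiom or
linearity law that holds in `P`; so only the relations `R` need a hypothesis. -/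
theorem Term.eval_eq_of_rel
    (hR : ∀ {n : ℕ} {c : Fin n → C} {c₀ : C} {p : ℤ} (x y : Term k X c c₀ p), R x y →
      x.eval P φ = y.eval P φ)
    {n : ℕ} {c : Fin n → C} {c₀ : C} {p : ℤ} {x y : Term k X c c₀ p} (h : Rel R x y) :
    x.eval P φ = y.eval P φ := by
  induction h with
  | of h => exact hR _ _ h
  | refl => rfl
  | symm _ ih => exact ih.symm
  | trans _ _ ih ih' => exact ih.trans ih'
  | add_congr _ _ ih ih' => simp only [Term.eval, ih, ih']
  | smul_congr a _ ih => simp only [Term.eval, ih]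
  | act_congr σ h _ ih => simp only [Term.eval, ih]
  | comp_congr A hr _ _ ih ih' => simp only [Term.eval, ih, ih']
  | add_comm => simp only [Term.eval, _root_.add_comm]
  | add_assoc => simp only [Term.eval, _root_.add_assoc]
  | zero_add => simp only [Term.eval, _root_.zero_add]
  | smul_add => simp only [Term.eval, _root_.smul_add]
  | add_smul => simp only [Term.eval, _root_.add_smul]
  | mul_smul => simp only [Term.eval, SemigroupAction.mul_smul]
  | one_smul => simp only [Term.eval, _root_.one_smul]
  | zero_smul => simp only [Term.eval, _root_.zero_smul]
  | act_add => simp only [Term.eval, map_add]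
  | act_smul => simp only [Term.eval, map_smul]
  | add_comp => simp only [Term.eval, map_add, LinearMap.add_apply]
  | smul_comp => simp only [Term.eval, map_smul, LinearMap.smul_apply]
  | comp_add => simp only [Term.eval, map_add]
  | comp_smul => simp only [Term.eval, map_smul]
  | act_refl h x => exact P.act_refl h _
  | act_act σ τ h h' h'' x => exact P.act_act σ τ h h' h'' _
  | act_comp hr σ h A B hAB x y => exact P.act_comp hr σ h A B hAB _ _
  | comp_act_left hr σ h A B hAB x y => exact P.comp_act_left hr σ h A B hAB _ _
  | comp_act_right hr τ h A B hAB x y => exact P.comp_act_right hr τ h A B hAB _ _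
  | comp_one hp A σ h hA hA' x => exact P.comp_one hp A σ h hA hA' _
  | one_comp hq A σ h hA y => exact P.one_comp hq A σ h hA _
  | assoc_seq h₁ h₂ h₃ h₄ A A' B B' hA x y z =>
    exact P.assoc_seq h₁ h₂ h₃ h₄ A A' B B' hA _ _ _
  | assoc_par hij hji h₁ h₂ h₃ h₄ A A' B B' hA x y z =>
    exact P.assoc_par hij hji h₁ h₂ h₃ h₄ A A' B B' hA _ _ _

/-- The morphism out of a presented operad given by the values of the generators. -/
def lift
    (hR : ∀ {n : ℕ} {c : Fin n → C} {c₀ : C} {p : ℤ} (x y : Term k X c c₀ p), R x y →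
      x.eval P φ = y.eval P φ) : GradedOperad.Hom (operad R) P where
  app _ _ _ :=
    { toFun := Quotient.lift (Term.eval P φ) (fun _ _ h => Term.eval_eq_of_rel P φ hR h)
      map_add' := by
        rintro ⟨x⟩ ⟨y⟩
        rfl
      map_smul' := by
        rintro a ⟨x⟩
        rfl }
  app_act := by
    rintro n c c' c₀ p σ h ⟨x⟩
    rfl
  app_one c := rfl
  app_comp := by
    rintro m n l c c₀ i d d₀ b p q r A hr ⟨x⟩ ⟨y⟩
    rfl

/-- A suboperad of a presented operad that contains the generators is everything. -/
theorem mem_of_gen_mem (T : (operad R).Suboperad)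
    (hT : ∀ {n : ℕ} {c : Fin n → C} {c₀ : C} {p : ℤ} (x : X c c₀ p),
      mk R (Term.gen x) ∈ T.carrier c c₀ p)
    {n : ℕ} {c : Fin n → C} {c₀ : C} {p : ℤ} (x : (operad R).obj c c₀ p) :
    x ∈ T.carrier c c₀ p := by
  obtain ⟨t, rfl⟩ : ∃ t, mk R t = x := Quotient.exists_rep x
  induction t with
  | gen x => exact hT x
  | zero => exact (T.carrier _ _ _).zero_mem
  | add x y ihx ihy => exact (T.carrier _ _ _).add_mem ihx ihy
  | smul a x ih => exact (T.carrier _ _ _).smul_mem a ih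
  | act σ h x ih => exact T.act_mem σ h _ ih
  | one c => exact T.one_mem c
  | comp A hr x y ihx ihy => exact T.comp_mem A hr _ _ ihx ihy

end OperadPresentation

/-! ### Universal properties of `Γ(E)` and of the free product; suboperads as an induction
principle. -/

namespace GradedOperad

open OperadPresentation

variable {k : Type u} [Field k] {C : Type v}

/-- The morphism `Γ(E) → P` extending a map of collections `E → P`. -/
def freeLift {E : GradedCollection.{u, v, w₁} k C} {P : GradedOperad.{u, v, w₂} k C}
    (α : GradedCollection.Hom E P.toGradedCollection) : Hom (free E) P :=
  OperadPresentation.lift P (fun x => α.app _ _ _ x) (by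
    intro n c c₀ p x y h
    cases h <;> simp only [Term.eval, map_add, map_smul, α.app_act])

/-- The morphism `P * Q → O` given by morphisms `P → O` and `Q → O`. -/
def coprodLift {P : GradedOperad.{u, v, w₁} k C} {Q : GradedOperad.{u, v, w₂} k C}
    {O : GradedOperad.{u, v, w₃} k C} (f : Hom P O) (g : Hom Q O) : Hom (coprod P Q) O :=
  OperadPresentation.lift O (fun x => Sum.elim (f.app _ _ _) (g.app _ _ _) x) (by
    intro n c c₀ p x y h
    cases h <;> simp only [Term.eval, Sum.elim_inl, Sum.elim_inr, map_add, map_smul, Hom.app_act,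
      Hom.app_one, Hom.app_comp])

/-- The composite of `f : P → O` with the inverse of a bijective morphism `φ : P → Q`. -/
noncomputable def Hom.compInverse {P : GradedOperad.{u, v, w₁} k C}
    {Q : GradedOperad.{u, v, w₂} k C} {O : GradedOperad.{u, v, w₃} k C} (f : Hom P O)
    (φ : Hom P Q)
    (hφ : ∀ {n : ℕ} (c : Fin n → C) (c₀ : C) (p : ℤ), Function.Bijective (φ.app c c₀ p)) :
    Hom Q O where
  app c c₀ p := f.app c c₀ p ∘ₗ (LinearEquiv.ofBijective _ (hφ c c₀ p)).symm.toLinearMap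
  app_act {n c c' c₀ p} σ h x := by
    obtain ⟨x, rfl⟩ := (hφ c c₀ p).2 x
    rw [← φ.app_act]
    simp [f.app_act]
  app_one c := by
    rw [← φ.app_one]
    simp [f.app_one]
  app_comp {m n l c c₀ i d d₀ b p q r} A hr x y := by
    obtain ⟨x, rfl⟩ := (hφ c c₀ p).2 x
    obtain ⟨y, rfl⟩ := (hφ d d₀ q).2 y
    rw [← φ.app_comp]
    simp [f.app_comp]

theorem Hom.compInverse_app {P : GradedOperad.{u, v, w₁} k C}
    {Q : GradedOperad.{u, v, w₂} k C} {O : GradedOperad.{u, v, w₃} k C} (f : Hom P O)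
    (φ : Hom P Q)
    (hφ : ∀ {n : ℕ} (c : Fin n → C) (c₀ : C) (p : ℤ), Function.Bijective (φ.app c c₀ p))
    {n : ℕ} {c : Fin n → C} {c₀ : C} {p : ℤ} (x : P.obj c c₀ p) :
    (f.compInverse φ hφ).app c c₀ p (φ.app c c₀ p x) = f.app c c₀ p x := by
  simp [Hom.compInverse]

/-- The preimage of a suboperad. -/
def Suboperad.comap {P : GradedOperad.{u, v, w₁} k C} {Q : GradedOperad.{u, v, w₂} k C}
    (T : Q.Suboperad) (f : Hom P Q) : P.Suboperad where
  carrier c c₀ p := (T.carrier c c₀ p).comap (f.app c c₀ p)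
  act_mem σ h x hx := by
    simpa only [Submodule.mem_comap, f.app_act] using T.act_mem σ h _ hx
  one_mem c := by
    simpa only [Submodule.mem_comap, f.app_one] using T.one_mem c
  comp_mem A hr x y hx hy := by
    simpa only [Submodule.mem_comap, f.app_comp] using T.comp_mem A hr _ _ hx hy

/-- The suboperad on which two morphisms agree. -/
def Hom.eqLocus {P : GradedOperad.{u, v, w₁} k C} {Q : GradedOperad.{u, v, w₂} k C}
    (f g : Hom P Q) : P.Suboperad where
  carrier c c₀ p := LinearMap.eqLocus (f.app c c₀ p) (g.app c c₀ p)
  act_mem σ h x hx := by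
    rw [LinearMap.mem_eqLocus] at hx ⊢
    rw [f.app_act, g.app_act, hx]
  one_mem c := by
    rw [LinearMap.mem_eqLocus, f.app_one, g.app_one]
  comp_mem A hr x y hx hy := by
    rw [LinearMap.mem_eqLocus] at hx hy ⊢
    rw [f.app_comp, g.app_comp, hx, hy]

/-- The inclusion `Q → P * Q` as a morphism. -/
def coprodInrHom (P : GradedOperad.{u, v, w₁} k C) (Q : GradedOperad.{u, v, w₂} k C) :
    Hom Q (coprod P Q) where
  app _ _ _ :=
    { toFun := coprodInr P Q
      map_add' := fun x y => mk_eq _ (.of (.inr_add x y))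
      map_smul' := fun a x => mk_eq _ (.of (.inr_smul a x)) }
  app_act σ h x := mk_eq _ (.of (.inr_act σ h x))
  app_one c := mk_eq _ (.of (.inr_one c))
  app_comp A hr x y := mk_eq _ (.of (.inr_comp A hr x y))

/-- A suboperad of `P * Γ(E)` that contains `P` and `E` is everything. -/
theorem mem_of_coprod_free {P : GradedOperad.{u, v, w₁} k C} {E : GradedCollection.{u, v, w₂} k C}
    (T : (coprod P (free E)).Suboperad)
    (hP : ∀ {n : ℕ} {c : Fin n → C} {c₀ : C} {p : ℤ} (x : P.obj c c₀ p),
      coprodInl P (free E) x ∈ T.carrier c c₀ p)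
    (hE : ∀ {n : ℕ} {c : Fin n → C} {c₀ : C} {p : ℤ} (x : E.obj c c₀ p),
      coprodInr P (free E) (freeOf E x) ∈ T.carrier c c₀ p)
    {n : ℕ} {c : Fin n → C} {c₀ : C} {p : ℤ} (x : (coprod P (free E)).obj c c₀ p) :
    x ∈ T.carrier c c₀ p := by
  refine mem_of_gen_mem T ?_ x
  rintro n c c₀ p (x | x)
  · exact hP x
  -- The right-hand generators of the free product are all elements of `Γ(E)`, itself a presented
  -- operad. Pulling `T` back to `Γ(E)` reduces the claim to the generators in `E`.
  · exact mem_of_gen_mem (T.comap (coprodInrHom P (free E))) hE x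

/-- The inclusion of the generators `E → P * Γ(E)` as a map of collections. -/
def coprodFreeOf (P : GradedOperad.{u, v, w₁} k C) (E : GradedCollection.{u, v, w₂} k C) :
    GradedCollection.Hom E (coprod P (free E)).toGradedCollection where
  app _ _ _ := (coprodInrHom P (free E)).app _ _ _ ∘ₗ
    { toFun := freeOf E
      map_add' := fun x y => mk_eq _ (.of (.add x y))
      map_smul' := fun a x => mk_eq _ (.of (.smul a x)) }
  app_act σ h x :=
    (congrArg (coprodInr P (free E)) (mk_eq _ (.of (.act σ h x)))).trans
      ((coprodInrHom P (free E)).app_act σ h (freeOf E x))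

end GradedOperad

/-! ### Gluing maps of collections along a direct sum decomposition. -/

namespace GradedCollection

variable {k : Type u} [Field k] {C : Type v}

/-- Maps of collections defined on the summands of a direct sum decomposition glue. -/
theorem exists_hom_of_isInternal {E : GradedCollection.{u, v, w₁} k C}
    {F : GradedCollection.{u, v, w₂} k C} {U : ℕ → E.Sub}
    (hU : ∀ {n : ℕ} (c : Fin n → C) (c₀ : C) (p : ℤ),
      DirectSum.IsInternal (fun N : ℕ => (U N).carrier c c₀ p))
    (β : ℕ → Hom E F) :
    ∃ α : Hom E F, ∀ (N : ℕ) {n : ℕ} (c : Fin n → C) (c₀ : C) (p : ℤ) (x : E.obj c c₀ p),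
      x ∈ (U N).carrier c c₀ p → α.app c c₀ p x = (β N).app c c₀ p x := by
  classical
  have hB : ∀ {n : ℕ} (c : Fin n → C) (c₀ : C) (p : ℤ), Function.Bijective
      (DirectSum.coeLinearMap (fun N : ℕ => (U N).carrier c c₀ p)) := hU
  let α : ∀ {n : ℕ} (c : Fin n → C) (c₀ : C) (p : ℤ), E.obj c c₀ p →ₗ[k] F.obj c c₀ p :=
    fun c c₀ p => DirectSum.toModule k ℕ (F.obj c c₀ p)
        (fun N => (β N).app c c₀ p ∘ₗ ((U N).carrier c c₀ p).subtype) ∘ₗ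
      (LinearEquiv.ofBijective
        (DirectSum.coeLinearMap (fun N : ℕ => (U N).carrier c c₀ p)) (hB c c₀ p)).symm.toLinearMap
  have key : ∀ (N : ℕ) {n : ℕ} (c : Fin n → C) (c₀ : C) (p : ℤ) (x : E.obj c c₀ p),
      x ∈ (U N).carrier c c₀ p → α c c₀ p x = (β N).app c c₀ p x := by
    intro N n c c₀ p x hx
    -- An element of the `N`-th summand has only its `N`-th component in the decomposition.
    have hx' : (LinearEquiv.ofBijective
        (DirectSum.coeLinearMap (fun N : ℕ => (U N).carrier c c₀ p)) (hB c c₀ p)).symm x =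
        DirectSum.lof k ℕ (fun N : ℕ => (U N).carrier c c₀ p) N ⟨x, hx⟩ := by
      rw [LinearEquiv.symm_apply_eq, LinearEquiv.ofBijective_apply, DirectSum.coeLinearMap_lof]
    simp only [α, LinearMap.comp_apply, LinearEquiv.coe_coe]
    rw [hx', DirectSum.toModule_lof]
    rfl
  refine ⟨⟨α, ?_⟩, key⟩
  intro n c c' c₀ p σ h x
  have hx : x ∈ ⨆ N, (U N).carrier c c₀ p := by
    rw [(hU c c₀ p).submodule_iSup_eq_top]
    trivial
  -- Equivariance is linear in `x`, hence may be checked on one summand. There `act_mem` keeps the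
  -- translate in the same summand, so both sides are computed by the same `β N`.
  induction hx using Submodule.iSup_induction' with
  | mem N x hx =>
    rw [key N c c₀ p x hx, key N c' c₀ p _ ((U N).act_mem σ h x hx), (β N).app_act]
  | zero => simp
  | add x y _ _ hx hy => simp only [map_add, hx, hy]

end GradedCollection

/-! ### Averaging over the symmetric groups. -/

namespace GradedCollection

variable {k : Type u} [Field k] {C : Type v}

/-- The zero map of collections. -/
instance (E : GradedCollection.{u, v, w₁} k C) (F : GradedCollection.{u, v, w₂} k C) :
    Inhabited (Hom E F) :=
  ⟨⟨fun _ _ _ => 0, fun _ _ _ => by simp⟩⟩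

/-- The average of a family of linear maps over the actions of the symmetric groups. -/
noncomputable def average {E : GradedCollection.{u, v, w₁} k C}
    {F : GradedCollection.{u, v, w₂} k C}
    (s : ∀ {n : ℕ} (c : Fin n → C) (c₀ : C) (p : ℤ), E.obj c c₀ p →ₗ[k] F.obj c c₀ p) :
    Hom E F where
  app {n} c c₀ p := ((n.factorial : k)⁻¹) • ∑ σ : Equiv.Perm (Fin n),
    F.act (c := fun t => c (σ t)) σ⁻¹ (fun t => by simp) ∘ₗ s (fun t => c (σ t)) c₀ p ∘ₗ
      E.act σ (fun _ => rfl)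
  app_act {n c c' c₀ p} τ h x := by
    -- With `c'` literally equal to `c ∘ τ`, the colourings `c' ∘ σ` and `c ∘ (τ * σ)` coincide by
    -- definition, so the same component of `s` occurs on both sides.
    obtain rfl : c' = fun t => c (τ t) := funext h
    simp only [LinearMap.smul_apply, LinearMap.sum_apply, LinearMap.comp_apply, map_smul, map_sum]
    congr 1
    -- The actions are right actions: `(x · τ) · σ = x · (τσ)`, and `(τσ)⁻¹τ = σ⁻¹`. Thus the term
    -- of `σ` on the left is the term of `τσ` on the right.
    refine Fintype.sum_equiv (Equiv.mulLeft τ) _ _ fun σ => ?_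
    rw [E.act_act τ σ h (fun _ => rfl) (fun _ => rfl)]
    rw [F.act_act _ τ _ h (fun t => by simp)]
    simp only [Equiv.coe_mulLeft, mul_inv_rev, inv_mul_cancel_right]
    rfl

/-- Averaging preserves the solutions of an equivariant linear equation. -/
theorem average_eq [CharZero k] {E : GradedCollection.{u, v, w₁} k C}
    {F : GradedCollection.{u, v, w₂} k C} {F' : GradedCollection.{u, v, w₃} k C}
    (s : ∀ {n : ℕ} (c : Fin n → C) (c₀ : C) (p : ℤ), E.obj c c₀ p →ₗ[k] F.obj c c₀ p)
    (U : E.Sub) {c₀ : C} {p q : ℤ}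
    (D : ∀ {n : ℕ} (c : Fin n → C), F.obj c c₀ p →ₗ[k] F'.obj c c₀ q)
    (hD : ∀ {n : ℕ} {c c' : Fin n → C} (σ : Equiv.Perm (Fin n)) (h : ∀ s, c' s = c (σ s))
      (x : F.obj c c₀ p), D c' (F.act σ h x) = F'.act σ h (D c x))
    (G : ∀ {n : ℕ} (c : Fin n → C), E.obj c c₀ p → F'.obj c c₀ q)
    (hG : ∀ {n : ℕ} {c c' : Fin n → C} (σ : Equiv.Perm (Fin n)) (h : ∀ s, c' s = c (σ s))
      (x : E.obj c c₀ p), G c' (E.act σ h x) = F'.act σ h (G c x))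
    (hs : ∀ {n : ℕ} (c : Fin n → C) (x : E.obj c c₀ p), x ∈ U.carrier c c₀ p →
      D c (s c c₀ p x) = G c x)
    {n : ℕ} (c : Fin n → C) (x : E.obj c c₀ p) (hx : x ∈ U.carrier c c₀ p) :
    D c ((average s).app c c₀ p x) = G c x := by
  -- Every summand is already a solution: `D(s(xσ)σ⁻¹) = D(s(xσ))σ⁻¹ = G(xσ)σ⁻¹ = G(x)`. Stability
  -- of `U` is needed to apply `hs` to `xσ`.
  have h : ∀ σ : Equiv.Perm (Fin n), D c (F.act (c := fun t => c (σ t)) σ⁻¹ (fun t => by simp)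
      (s (fun t => c (σ t)) c₀ p (E.act σ (fun _ => rfl) x))) = G c x := by
    intro σ
    rw [hD, hs _ _ (U.act_mem σ _ x hx), hG, F'.act_act σ σ⁻¹ _ _ (fun t => by simp)]
    simp only [mul_inv_cancel]
    exact F'.act_refl _ _
  simp only [average, LinearMap.smul_apply, LinearMap.sum_apply, LinearMap.comp_apply, map_smul,
    map_sum, h, Finset.sum_const, Finset.card_univ, Fintype.card_perm, Fintype.card_fin]
  -- The sum is `n!` copies of `G x`; characteristic zero makes `n!` invertible.
  rw [← Nat.cast_smul_eq_nsmul k, smul_smul,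
    inv_mul_cancel₀ (Nat.cast_ne_zero.mpr n.factorial_ne_zero), one_smul]

end GradedCollection

/-- The composite `f` after `g` of morphisms of graded operads. -/
def GradedOperad.Hom.comp {k : Type u} [Field k] {C : Type v} {P : GradedOperad.{u, v, w₁} k C}
    {Q : GradedOperad.{u, v, w₂} k C} {R : GradedOperad.{u, v, w₃} k C} (f : Hom Q R)
    (g : Hom P Q) : Hom P R where
  app c c₀ p := f.app c c₀ p ∘ₗ g.app c c₀ p
  app_act σ h x := by simp [g.app_act, f.app_act]
  app_one c := by simp [g.app_one, f.app_one]
  app_comp A hr x y := by simp [g.app_comp, f.app_comp]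

/-- An element of a generated suboperad lies in every suboperad that contains the generators. -/
theorem GradedOperad.mem_of_mem_generated {k : Type u} [Field k] {C : Type v}
    {P : GradedOperad.{u, v, w} k C}
    {G : ∀ {n : ℕ} (c : Fin n → C) (c₀ : C) (p : ℤ), Set (P.obj c c₀ p)}
    {n : ℕ} {c : Fin n → C} {c₀ : C} {p : ℤ} {x : P.obj c c₀ p} (hx : x ∈ P.generated G c c₀ p)
    (T : P.Suboperad)
    (hT : ∀ {m : ℕ} (b : Fin m → C) (b₀ : C) (q : ℤ), ∀ y ∈ G b b₀ q, y ∈ T.carrier b b₀ q) :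
    x ∈ T.carrier c c₀ p :=
  hx T hT

/-! ### Differentials, and lifting against a surjective homology isomorphism. -/

namespace DGOperad

variable {k : Type u} [Field k] {C : Type v}

/-- The suboperad on which a morphism of graded operads commutes with the differentials. -/
def commLocus {Q : DGOperad.{u, v, w₁} k C} {X : DGOperad.{u, v, w₂} k C}
    (h : GradedOperad.Hom Q.toGradedOperad X.toGradedOperad) : Q.toGradedOperad.Suboperad where
  carrier c c₀ p :=
    { carrier := {x | ∀ (q : ℤ) (hd : q + 1 = p),
        h.app c c₀ q (Q.d c c₀ hd x) = X.d c c₀ hd (h.app c c₀ p x)}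
      add_mem' := fun hx hy q hd => by simp only [map_add, hx q hd, hy q hd]
      zero_mem' := fun q hd => by simp only [map_zero]
      smul_mem' := fun a x hx q hd => by simp only [map_smul, hx q hd] }
  act_mem σ hσ x hx q hd := by
    rw [Q.d_act, h.app_act, hx q hd, h.app_act, X.d_act]
  one_mem c q hd := by
    rw [Q.d_one, h.app_one, X.d_one, map_zero]
  comp_mem {m n l c c₀ i d d₀ b p q r} A hr x y hx hy r' hd := by
    -- The Leibniz rules in `Q` and `X` carry the same sign, as it depends only on the degree `p`,
    -- which `h` preserves.
    rw [Q.d_comp A hr (sub_add_cancel p 1) (sub_add_cancel q 1) hd (by lia) (by lia) x y,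
      h.app_comp, X.d_comp A hr (sub_add_cancel p 1) (sub_add_cancel q 1) hd (by lia) (by lia),
      map_add, map_smul, h.app_comp, h.app_comp, hx, hy]

theorem mem_commLocus {Q : DGOperad.{u, v, w₁} k C} {X : DGOperad.{u, v, w₂} k C}
    {h : GradedOperad.Hom Q.toGradedOperad X.toGradedOperad}
    {n : ℕ} {c : Fin n → C} {c₀ : C} {p : ℤ} {x : Q.obj c c₀ p} :
    x ∈ (commLocus h).carrier c c₀ p ↔ ∀ (q : ℤ) (hd : q + 1 = p),
      h.app c c₀ q (Q.d c c₀ hd x) = X.d c c₀ hd (h.app c c₀ p x) :=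
  Iff.rfl

/-- `cycles` fixes the target degree as `p - 1`; this form frees it, so that degrees such as `q + 1`
need no casts. -/
theorem mem_cycles (P : DGOperad.{u, v, w} k C) {n : ℕ} {c : Fin n → C} {c₀ : C} {p q : ℤ}
    (h : q + 1 = p) {x : P.obj c c₀ p} : x ∈ P.cycles c c₀ p ↔ P.d c c₀ h x = 0 := by
  obtain rfl : q = p - 1 := by lia
  exact Iff.rfl

variable {X : DGOperad.{u, v, w₁} k C} {Y : DGOperad.{u, v, w₂} k C}

/-- The kernel of a surjective homology isomorphism is acyclic. -/
theorem Hom.exists_d_eq_of_app_eq_zero (π : Hom X Y) (hs : π.IsSurjective)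
    (hi : π.IsHomologyIso) {n : ℕ} {c : Fin n → C} {c₀ : C} {p q : ℤ} (hd : q + 1 = p)
    {z : X.obj c c₀ q} (hz : z ∈ X.cycles c c₀ q) (hπ : π.app c c₀ q z = 0) :
    ∃ b : X.obj c c₀ p, X.d c c₀ hd b = z ∧ π.app c c₀ p b = 0 := by
  subst hd
  have h0 : π.homologyMap c c₀ q ((X.boundaries c c₀ q).mkQ ⟨z, hz⟩) = 0 := by
    have h1 : π.cyclesMap c c₀ q ⟨z, hz⟩ = 0 := Subtype.ext hπ
    rw [Hom.homologyMap, Submodule.mkQ_apply, Submodule.mapQ_apply, h1, Submodule.Quotient.mk_zero]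
  -- Injectivity on homology makes `z` a boundary `∂b`, but `π b` may be nonzero.
  have h2 := (hi c c₀ q).1 (h0.trans (map_zero _).symm)
  rw [Submodule.mkQ_apply, Submodule.Quotient.mk_eq_zero] at h2
  obtain ⟨b, hb⟩ : ∃ b, X.d c c₀ (rfl : q + 1 = q + 1) b = z := h2
  -- The defect `π b` is a cycle, as `∂(π b) = π z = 0`. Surjectivity on homology, one degree up,
  -- gives a cycle `w` with `π w - π b = ∂y`; surjectivity of `π` then gives `y = π x`.
  have hc : π.app c c₀ (q + 1) b ∈ Y.cycles c c₀ (q + 1) := by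
    rw [Y.mem_cycles rfl, ← π.app_d, hb, hπ]
  obtain ⟨w, hw⟩ := (hi c c₀ (q + 1)).2 ((Y.boundaries c c₀ (q + 1)).mkQ ⟨_, hc⟩)
  obtain ⟨w, rfl⟩ := Submodule.mkQ_surjective _ w
  rw [Hom.homologyMap, Submodule.mkQ_apply, Submodule.mapQ_apply, Submodule.mkQ_apply,
    Submodule.Quotient.eq] at hw
  obtain ⟨y, hy⟩ : ∃ y, Y.d c c₀ rfl y = π.app c c₀ (q + 1) w - π.app c c₀ (q + 1) b := hw
  obtain ⟨x, rfl⟩ := hs c c₀ _ y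
  have hw' : X.d c c₀ rfl (w : X.obj c c₀ (q + 1)) = 0 := (X.mem_cycles rfl).1 w.2
  -- Subtracting the cycle `w` and adding the boundary `∂x` does not change the differential and
  -- cancels `π b`.
  refine ⟨b - w + X.d c c₀ rfl x, ?_, ?_⟩
  · rw [map_add, map_sub, hb, hw', X.d_d]
    simp
  · rw [map_add, map_sub, π.app_d, hy]
    abel

/-- Linear lifting against a surjective homology isomorphism, with prescribed differential. -/
theorem Hom.exists_linear_lift (π : Hom X Y) (hs : π.IsSurjective)
    (hi : π.IsHomologyIso) {n : ℕ} {c : Fin n → C} {c₀ : C} {p q : ℤ} (hd : q + 1 = p)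
    {V : Type w} [AddCommGroup V] [Module k V] (G : V →ₗ[k] Y.obj c c₀ p)
    (Z : V →ₗ[k] X.obj c c₀ q) (hZ : ∀ v, Z v ∈ X.cycles c c₀ q)
    (hGZ : ∀ v, π.app c c₀ q (Z v) = Y.d c c₀ hd (G v)) :
    ∃ s : V →ₗ[k] X.obj c c₀ p, ∀ v, π.app c c₀ p (s v) = G v ∧ X.d c c₀ hd (s v) = Z v := by
  -- Both equations together say `D (s v) = (G v, Z v)`. Solvability for each `v` puts the right
  -- side in the range of `D`, and a linear choice then exists because `V` is projective over the
  -- field.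
  let D := (π.app c c₀ p).prod (X.d c c₀ hd)
  have hD : ∀ v, (G.prod Z) v ∈ LinearMap.range D := by
    intro v
    obtain ⟨a, ha⟩ := hs c c₀ p (G v)
    -- For any `a` over `G v`, the error `Z v - ∂a` is a cycle in the kernel of `π`, hence the
    -- boundary of some `b` in that kernel; `a + b` solves both equations.
    obtain ⟨b, hb, hb'⟩ := π.exists_d_eq_of_app_eq_zero hs hi hd (z := Z v - X.d c c₀ hd a)
      (Submodule.sub_mem _ (hZ v) ((X.mem_cycles (sub_add_cancel q 1)).2 (X.d_d c c₀ _ _ _)))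
      (by rw [map_sub, hGZ, π.app_d, ha, sub_self])
    refine ⟨a + b, Prod.ext ?_ ?_⟩
    · change π.app c c₀ p (a + b) = G v
      rw [map_add, ha, hb', add_zero]
    · change X.d c c₀ hd (a + b) = Z v
      rw [map_add, hb]
      abel
  obtain ⟨s, hs⟩ := Module.projective_lifting_property D.rangeRestrict
    ((G.prod Z).codRestrict _ hD) D.surjective_rangeRestrict
  refine ⟨s, fun v => ?_⟩
  have h : D (s v) = (G.prod Z) v := congrArg Subtype.val (LinearMap.congr_fun hs v)
  exact ⟨congrArg Prod.fst h, congrArg Prod.snd h⟩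

end DGOperad

/-! ### Induction along the filtration of the generators. -/

namespace DGOperad

variable {k : Type u} [Field k] {C : Type v}
  {S : DGOperad.{u, v, w₁} k C} {Q : DGOperad.{u, v, w₂} k C}
  {X : DGOperad.{u, v, w₃} k C} {Y : DGOperad.{u, v, w₄} k C}
  {E : GradedCollection.{u, v, w} k C}

/-- The map of collections `α : E → X` lifts `g` on the generators `ε : E → Q` that lie in `E_j`
for `j < N`, and the morphism `h` commutes with the differential on their images. -/
def LiftsBelow (U : ℕ → E.Sub) (ε : E.Hom Q.toGradedCollection) (π : Hom X Y) (g : Hom Q Y)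
    (h : GradedOperad.Hom Q.toGradedOperad X.toGradedOperad)
    (α : E.Hom X.toGradedCollection) (N : ℕ) : Prop :=
  ∀ j < N, ∀ {n : ℕ} (c : Fin n → C) (c₀ : C) (p : ℤ), ∀ e ∈ (U j).carrier c c₀ p,
    π.app c c₀ p (α.app c c₀ p e) = g.app c c₀ p (ε.app c c₀ p e) ∧
    ∀ (q : ℤ) (hd : q + 1 = p),
      X.d c c₀ hd (α.app c c₀ p e) = h.app c c₀ q (Q.d c c₀ hd (ε.app c c₀ p e))

/-- The generators `S` and `E_j`, `j < N`, of the `N`-th stage of an elemental cofibration. -/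
def stageGenerators (U : ℕ → E.Sub) (ι : Hom S Q) (ε : E.Hom Q.toGradedCollection) (N : ℕ)
    {n : ℕ} (c : Fin n → C) (c₀ : C) (p : ℤ) : Set (Q.obj c c₀ p) :=
  Set.range (ι.app c c₀ p) ∪ {y | ∃ j < N, ∃ e ∈ (U j).carrier c c₀ p, y = ε.app c c₀ p e}

variable {U : ℕ → E.Sub} {ι : Hom S Q} {ε : E.Hom Q.toGradedCollection}
  {π : Hom X Y} {f : Hom S X} {g : Hom Q Y}
  {Φ : E.Hom X.toGradedCollection → GradedOperad.Hom Q.toGradedOperad X.toGradedOperad}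

/-- The extensions of two maps of collections that agree on `E_j` for `j < N` agree on the `N`-th
stage. -/
theorem extension_congr
    (hΦι : ∀ α {n : ℕ} (c : Fin n → C) (c₀ : C) (p : ℤ) (x : S.obj c c₀ p),
      (Φ α).app c c₀ p (ι.app c c₀ p x) = f.app c c₀ p x)
    (hΦε : ∀ α {n : ℕ} (c : Fin n → C) (c₀ : C) (p : ℤ) (x : E.obj c c₀ p),
      (Φ α).app c c₀ p (ε.app c c₀ p x) = α.app c c₀ p x)
    {N : ℕ} {α β : E.Hom X.toGradedCollection}
    (h : ∀ j < N, ∀ {n : ℕ} (c : Fin n → C) (c₀ : C) (p : ℤ), ∀ e ∈ (U j).carrier c c₀ p,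
      α.app c c₀ p e = β.app c c₀ p e)
    {n : ℕ} {c : Fin n → C} {c₀ : C} {p : ℤ} {x : Q.obj c c₀ p}
    (hx : x ∈ Q.generated (stageGenerators U ι ε N) c c₀ p) :
    (Φ α).app c c₀ p x = (Φ β).app c c₀ p x := by
  refine GradedOperad.mem_of_mem_generated hx ((Φ α).eqLocus (Φ β)) ?_
  rintro m b b₀ q _ (⟨y, rfl⟩ | ⟨j, hj, e, he, rfl⟩)
  · exact (hΦι α b b₀ q y).trans (hΦι β b b₀ q y).symm
  · exact (hΦε α b b₀ q e).trans ((h j hj b b₀ q e he).trans (hΦε β b b₀ q e).symm)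

theorem generated_mono {N N' : ℕ} (hN : N ≤ N')
    {n : ℕ} {c : Fin n → C} {c₀ : C} {p : ℤ} {x : Q.obj c c₀ p}
    (hx : x ∈ Q.generated (stageGenerators U ι ε N) c c₀ p) :
    x ∈ Q.generated (stageGenerators U ι ε N') c c₀ p := by
  intro T hT
  refine GradedOperad.mem_of_mem_generated hx T fun b b₀ q y hy => hT b b₀ q ?_
  rcases hy with hy | ⟨j, hj, e, he, rfl⟩
  · exact Or.inl hy
  · exact Or.inr ⟨j, hj.trans_le hN, e, he, rfl⟩

/-- The locus where `π ∘ h` and `g` agree is a suboperad; it contains `S` by the commutative square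
and `E_j` by the first half of `LiftsBelow`. -/
theorem LiftsBelow.app_eq {N : ℕ} {α : E.Hom X.toGradedCollection}
    {h : GradedOperad.Hom Q.toGradedOperad X.toGradedOperad}
    (hα : LiftsBelow U ε π g h α N) (comm : π.comp f = g.comp ι)
    (hι : ∀ {n : ℕ} (c : Fin n → C) (c₀ : C) (p : ℤ) (x : S.obj c c₀ p),
      h.app c c₀ p (ι.app c c₀ p x) = f.app c c₀ p x)
    (hε : ∀ {n : ℕ} (c : Fin n → C) (c₀ : C) (p : ℤ) (x : E.obj c c₀ p),
      h.app c c₀ p (ε.app c c₀ p x) = α.app c c₀ p x)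
    {n : ℕ} {c : Fin n → C} {c₀ : C} {p : ℤ} {x : Q.obj c c₀ p}
    (hx : x ∈ Q.generated (stageGenerators U ι ε N) c c₀ p) :
    π.app c c₀ p (h.app c c₀ p x) = g.app c c₀ p x := by
  refine GradedOperad.mem_of_mem_generated hx ((π.toHom.comp h).eqLocus g.toHom) ?_
  rintro m b b₀ q _ (⟨y, rfl⟩ | ⟨j, hj, e, he, rfl⟩)
  · change π.app b b₀ q (h.app b b₀ q (ι.app b b₀ q y)) = g.app b b₀ q (ι.app b b₀ q y)
    rw [hι]
    exact congrArg (fun F : Hom S Y => F.app b b₀ q y) comm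
  · change π.app b b₀ q (h.app b b₀ q (ε.app b b₀ q e)) = g.app b b₀ q (ε.app b b₀ q e)
    rw [hε]
    exact (hα j hj b b₀ q e he).1

/-- `commLocus h` is a suboperad; it contains `S` because `ι` and `f` are chain maps, and `E_j` by
the second half of `LiftsBelow`. -/
theorem LiftsBelow.app_d {N : ℕ} {α : E.Hom X.toGradedCollection}
    {h : GradedOperad.Hom Q.toGradedOperad X.toGradedOperad}
    (hα : LiftsBelow U ε π g h α N)
    (hι : ∀ {n : ℕ} (c : Fin n → C) (c₀ : C) (p : ℤ) (x : S.obj c c₀ p),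
      h.app c c₀ p (ι.app c c₀ p x) = f.app c c₀ p x)
    (hε : ∀ {n : ℕ} (c : Fin n → C) (c₀ : C) (p : ℤ) (x : E.obj c c₀ p),
      h.app c c₀ p (ε.app c c₀ p x) = α.app c c₀ p x)
    {n : ℕ} {c : Fin n → C} {c₀ : C} {p q : ℤ} (hd : q + 1 = p) {x : Q.obj c c₀ p}
    (hx : x ∈ Q.generated (stageGenerators U ι ε N) c c₀ p) :
    h.app c c₀ q (Q.d c c₀ hd x) = X.d c c₀ hd (h.app c c₀ p x) := by
  refine mem_commLocus.1 (GradedOperad.mem_of_mem_generated hx (commLocus h) ?_) q hd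
  rintro m b b₀ r _ (⟨y, rfl⟩ | ⟨j, hj, e, he, rfl⟩)
  · intro r' hr
    rw [← ι.app_d, hι, hι, f.app_d]
  · intro r' hr
    rw [hε]
    exact ((hα j hj b b₀ r e he).2 r' hr).symm

/-- A lift defined on `E_j` for `j < N` extends to `E_N`. -/
theorem LiftsBelow.exists_succ [CharZero k] (hs : π.IsSurjective) (hi : π.IsHomologyIso)
    (comm : π.comp f = g.comp ι)
    (hU : ∀ {n : ℕ} (c : Fin n → C) (c₀ : C) (p : ℤ),
      DirectSum.IsInternal (fun N : ℕ => (U N).carrier c c₀ p))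
    (hgen : ∀ (N : ℕ) {n : ℕ} (c : Fin n → C) (c₀ : C) {p q : ℤ} (hd : q + 1 = p),
      ∀ x ∈ (U N).carrier c c₀ p,
      Q.d c c₀ hd (ε.app c c₀ p x) ∈ Q.generated (stageGenerators U ι ε N) c c₀ q)
    (hΦι : ∀ α {n : ℕ} (c : Fin n → C) (c₀ : C) (p : ℤ) (x : S.obj c c₀ p),
      (Φ α).app c c₀ p (ι.app c c₀ p x) = f.app c c₀ p x)
    (hΦε : ∀ α {n : ℕ} (c : Fin n → C) (c₀ : C) (p : ℤ) (x : E.obj c c₀ p),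
      (Φ α).app c c₀ p (ε.app c c₀ p x) = α.app c c₀ p x)
    {N : ℕ} {α : E.Hom X.toGradedCollection} (hα : LiftsBelow U ε π g (Φ α) α N) :
    ∃ α' : E.Hom X.toGradedCollection, LiftsBelow U ε π g (Φ α') α' (N + 1) ∧
      ∀ j < N, ∀ {n : ℕ} (c : Fin n → C) (c₀ : C) (p : ℤ), ∀ e ∈ (U j).carrier c c₀ p,
        α'.app c c₀ p e = α.app c c₀ p e := by
  have hlin : ∀ {n : ℕ} (c : Fin n → C) (c₀ : C) (p : ℤ),
      ∃ s : E.obj c c₀ p →ₗ[k] X.obj c c₀ p, ∀ e ∈ (U N).carrier c c₀ p,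
        π.app c c₀ p (s e) = g.app c c₀ p (ε.app c c₀ p e) ∧
        X.d c c₀ (sub_add_cancel p 1) (s e) =
          (Φ α).app c c₀ (p - 1) (Q.d c c₀ (sub_add_cancel p 1) (ε.app c c₀ p e)) := by
    intro n c c₀ p
    obtain ⟨s, hs⟩ := π.exists_linear_lift hs hi (sub_add_cancel p 1)
      (g.app c c₀ p ∘ₗ ε.app c c₀ p ∘ₗ ((U N).carrier c c₀ p).subtype)
      ((Φ α).app c c₀ (p - 1) ∘ₗ Q.d c c₀ (sub_add_cancel p 1) ∘ₗ ε.app c c₀ p ∘ₗ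
        ((U N).carrier c c₀ p).subtype)
      -- The prescribed differential is a cycle: `Φ α` commutes with `∂` on the `N`-th stage, which
      -- contains `∂e`, and `∂∂e = 0`.
      (by
        rintro ⟨e, he⟩
        refine (X.mem_cycles (sub_add_cancel (p - 1) 1)).2 ?_
        refine (hα.app_d (hΦι α) (hΦε α) (sub_add_cancel (p - 1) 1)
          (hgen N c c₀ (sub_add_cancel p 1) e he)).symm.trans ?_
        rw [Q.d_d, map_zero])
      (by
        rintro ⟨e, he⟩
        refine (hα.app_eq comm (hΦι α) (hΦε α)
          (hgen N c c₀ (sub_add_cancel p 1) e he)).trans ?_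
        exact g.app_d c c₀ (sub_add_cancel p 1) _)
    -- Averaging takes maps defined on all of `E`, so the solution on `E_N` is extended by an
    -- arbitrary linear map; its values off `E_N` play no role.
    obtain ⟨t, ht⟩ := s.exists_extend
    refine ⟨t, fun e he => ?_⟩
    have h : t e = s ⟨e, he⟩ := LinearMap.congr_fun ht ⟨e, he⟩
    rw [h]
    exact hs ⟨e, he⟩
  choose s hs₁ using @hlin
  let β : E.Hom X.toGradedCollection := GradedCollection.average s
  have hβ₁ : ∀ {n : ℕ} (c : Fin n → C) (c₀ : C) (p : ℤ), ∀ e ∈ (U N).carrier c c₀ p,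
      π.app c c₀ p (β.app c c₀ p e) = g.app c c₀ p (ε.app c c₀ p e) := by
    intro n c c₀ p e he
    exact GradedCollection.average_eq (F' := Y.toGradedCollection) s (U N)
      (fun c => π.app c c₀ p) (fun σ h x => π.app_act σ h x)
      (fun c e => g.app c c₀ p (ε.app c c₀ p e)) (fun σ h x => by rw [ε.app_act, g.app_act])
      (fun c x hx => (hs₁ c c₀ p x hx).1) c e he
  have hβ₂ : ∀ {n : ℕ} (c : Fin n → C) (c₀ : C) (p : ℤ), ∀ e ∈ (U N).carrier c c₀ p,
      X.d c c₀ (sub_add_cancel p 1) (β.app c c₀ p e) =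
          (Φ α).app c c₀ (p - 1) (Q.d c c₀ (sub_add_cancel p 1) (ε.app c c₀ p e)) := by
    intro n c c₀ p e he
    exact GradedCollection.average_eq (F' := X.toGradedCollection) s (U N)
      (fun c => X.d c c₀ (sub_add_cancel p 1)) (fun σ h x => X.d_act _ σ h x)
      (fun c e => (Φ α).app c c₀ (p - 1) (Q.d c c₀ (sub_add_cancel p 1) (ε.app c c₀ p e)))
      (fun σ h x => by rw [ε.app_act, Q.d_act, (Φ α).app_act])
      (fun c x hx => (hs₁ c c₀ p x hx).2) c e he
  -- The new map is `β` on `E_N` and the old `α` on every other summand.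
  obtain ⟨α', hα'⟩ := GradedCollection.exists_hom_of_isInternal hU
    (fun M => if M = N then β else α)
  have hlt : ∀ j < N, ∀ {n : ℕ} (c : Fin n → C) (c₀ : C) (p : ℤ), ∀ e ∈ (U j).carrier c c₀ p,
      α'.app c c₀ p e = α.app c c₀ p e := by
    intro j hj n c c₀ p e he
    rw [hα' j c c₀ p e he, if_neg hj.ne]
  refine ⟨α', ?_, hlt⟩
  intro j hj n c c₀ p e he
  -- The equation for `∂(α' e)` involves `Φ α'`, while `β` was built from `Φ α`. The two agree on
  -- `∂e`, which lies in the `N`-th stage, where only summands `E_i` with `i < N` enter.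
  have hΦ : ∀ (q : ℤ) (hd : q + 1 = p), (Φ α').app c c₀ q (Q.d c c₀ hd (ε.app c c₀ p e)) =
      (Φ α).app c c₀ q (Q.d c c₀ hd (ε.app c c₀ p e)) := fun q hd =>
    extension_congr hΦι hΦε hlt
      (generated_mono (Nat.lt_succ_iff.1 hj) (hgen j c c₀ hd e he))
  rcases Nat.lt_succ_iff_lt_or_eq.1 hj with hj | rfl
  · rw [hlt j hj c c₀ p e he]
    exact ⟨(hα j hj c c₀ p e he).1, fun q hd => (hΦ q hd).symm ▸ (hα j hj c c₀ p e he).2 q hd⟩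
  · rw [hα' j c c₀ p e he, if_pos rfl]
    refine ⟨hβ₁ c c₀ p e he, fun q hd => ?_⟩
    obtain rfl : q = p - 1 := by lia
    exact (hβ₂ c c₀ p e he).trans (hΦ _ _).symm

/-- There is a map of collections that lifts `g` on all generators. -/
theorem exists_liftsBelow [CharZero k] (hs : π.IsSurjective) (hi : π.IsHomologyIso)
    (comm : π.comp f = g.comp ι)
    (hU : ∀ {n : ℕ} (c : Fin n → C) (c₀ : C) (p : ℤ),
      DirectSum.IsInternal (fun N : ℕ => (U N).carrier c c₀ p))
    (hgen : ∀ (N : ℕ) {n : ℕ} (c : Fin n → C) (c₀ : C) {p q : ℤ} (hd : q + 1 = p),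
      ∀ x ∈ (U N).carrier c c₀ p,
      Q.d c c₀ hd (ε.app c c₀ p x) ∈ Q.generated (stageGenerators U ι ε N) c c₀ q)
    (hΦι : ∀ α {n : ℕ} (c : Fin n → C) (c₀ : C) (p : ℤ) (x : S.obj c c₀ p),
      (Φ α).app c c₀ p (ι.app c c₀ p x) = f.app c c₀ p x)
    (hΦε : ∀ α {n : ℕ} (c : Fin n → C) (c₀ : C) (p : ℤ) (x : E.obj c c₀ p),
      (Φ α).app c c₀ p (ε.app c c₀ p x) = α.app c c₀ p x) :
    ∃ α : E.Hom X.toGradedCollection, ∀ N, LiftsBelow U ε π g (Φ α) α N := by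
  choose F hF hF' using fun (N : ℕ)
    (α : {α : E.Hom X.toGradedCollection // LiftsBelow U ε π g (Φ α) α N}) =>
    α.2.exists_succ hs hi comm hU hgen hΦι hΦε
  let A : ∀ N, {α : E.Hom X.toGradedCollection // LiftsBelow U ε π g (Φ α) α N} := fun N =>
    -- The recursion starts from the zero map, since nothing is required below `0`.
    Nat.rec ⟨default, fun j hj => absurd hj j.not_lt_zero⟩ (fun N α => ⟨F N α, hF N α⟩) N
  -- The values on `E_j` are fixed at step `j + 1` and never change afterwards.
  have hA : ∀ j N, j < N → ∀ {n : ℕ} (c : Fin n → C) (c₀ : C) (p : ℤ),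
      ∀ e ∈ (U j).carrier c c₀ p, (A N).1.app c c₀ p e = (A (j + 1)).1.app c c₀ p e := by
    intro j N hN n c c₀ p e he
    induction N, Nat.succ_le_of_lt hN using Nat.le_induction with
    | base => rfl
    | succ N hjN ih => exact (hF' N (A N) j hjN c c₀ p e he).trans (ih hjN)
  obtain ⟨α, hα⟩ := GradedCollection.exists_hom_of_isInternal hU (fun N => (A (N + 1)).1)
  refine ⟨α, fun N j hj n c c₀ p e he => ?_⟩
  rw [hα j c c₀ p e he]
  have h := (A (j + 1)).2 j j.lt_succ_self c c₀ p e he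
  refine ⟨h.1, fun q hd => (h.2 q hd).trans ?_⟩
  -- `∂e` involves only `E_i` with `i < j`, where the glued map equals `A (i + 1)`, hence also `A (j
  -- + 1)`.
  refine extension_congr hΦι hΦε ?_ (hgen j c c₀ hd e he)
  intro i hij m b b₀ r y hy
  rw [hα i b b₀ r y hy, hA i (j + 1) (hij.trans j.lt_succ_self) b b₀ r y hy]

end DGOperad

/-! ### Assembly of the lift. -/

theorem mainTheorem7 {k : Type u} [Field k] [CharZero k] {C : Type v}
    {S : DGOperad.{u, v, w₁} k C} {Q : DGOperad.{u, v, w₂} k C}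
    {X : DGOperad.{u, v, w₃} k C} {Y : DGOperad.{u, v, w₄} k C}
    (ι : DGOperad.Hom S Q) (p : DGOperad.Hom X Y) (f : DGOperad.Hom S X) (g : DGOperad.Hom Q Y)
    (hι : ι.IsElementalCofibration) (hp : p.IsSurjective) (hp' : p.IsHomologyIso)
    (comm : p.comp f = g.comp ι) :
    ∃ h : DGOperad.Hom Q X, h.comp ι = f ∧ p.comp h = g := by
  obtain ⟨E, U, φ, hU, hφ, hφι, hgen⟩ := hι
  -- With this `ε`, the filtration condition `hgen` of the cofibration is by definition a statement
  -- about `stageGenerators U ι ε N`.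
  let ε : E.Hom Q.toGradedCollection :=
    ⟨fun c c₀ q => φ.app c c₀ q ∘ₗ (GradedOperad.coprodFreeOf S.toGradedOperad E).app c c₀ q,
      fun σ h x => by simp only [LinearMap.comp_apply, GradedCollection.Hom.app_act, φ.app_act]⟩
  let Φ : E.Hom X.toGradedCollection → GradedOperad.Hom Q.toGradedOperad X.toGradedOperad :=
    fun α => (GradedOperad.coprodLift f.toHom (GradedOperad.freeLift α)).compInverse φ hφ
  have hΦι : ∀ α {n : ℕ} (c : Fin n → C) (c₀ : C) (q : ℤ) (x : S.obj c c₀ q),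
      (Φ α).app c c₀ q (ι.app c c₀ q x) = f.app c c₀ q x := fun α n c c₀ q x => by
    rw [← hφι]
    exact GradedOperad.Hom.compInverse_app _ φ hφ _
  have hΦε : ∀ α {n : ℕ} (c : Fin n → C) (c₀ : C) (q : ℤ) (x : E.obj c c₀ q),
      (Φ α).app c c₀ q (ε.app c c₀ q x) = α.app c c₀ q x := fun α n c c₀ q x =>
    GradedOperad.Hom.compInverse_app _ φ hφ _
  obtain ⟨α, hα⟩ := DGOperad.exists_liftsBelow (ε := ε) hp hp' comm hU hgen hΦι hΦε
  -- `Q` is generated by `S` and the `E_N`, so both remaining properties of `Φ α` reduce to these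
  -- generators.
  have htop : ∀ (T : Q.toGradedOperad.Suboperad),
      (∀ {n : ℕ} (c : Fin n → C) (c₀ : C) (q : ℤ) (x : S.obj c c₀ q),
        ι.app c c₀ q x ∈ T.carrier c c₀ q) →
      (∀ (N : ℕ) {n : ℕ} (c : Fin n → C) (c₀ : C) (q : ℤ), ∀ e ∈ (U N).carrier c c₀ q,
        ε.app c c₀ q e ∈ T.carrier c c₀ q) →
      ∀ {n : ℕ} (c : Fin n → C) (c₀ : C) (q : ℤ) (x : Q.obj c c₀ q), x ∈ T.carrier c c₀ q := by
    intro T hS hE n c c₀ q x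
    obtain ⟨x, rfl⟩ := (hφ c c₀ q).2 x
    refine GradedOperad.mem_of_coprod_free (T.comap φ) (fun x => ?_) (fun {n c c₀ q} x => ?_) x
    · have h := hS _ _ _ x
      rw [← hφι] at h
      exact h
    · have hx : x ∈ ⨆ N, (U N).carrier c c₀ q := by
        rw [(hU c c₀ q).submodule_iSup_eq_top]
        trivial
      refine (iSup_le (fun N e he => ?_) :
        ⨆ N, (U N).carrier c c₀ q ≤ (T.carrier c c₀ q).comap (ε.app c c₀ q)) hx
      exact hE N c c₀ q e he
  refine ⟨⟨Φ α, fun {n} c c₀ {q r} hd x => ?_⟩, ?_, ?_⟩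
  · refine DGOperad.mem_commLocus.1 (htop (DGOperad.commLocus (Φ α)) ?_ ?_ c c₀ q x) r hd
    · intro m b b₀ s y s' hs
      rw [← ι.app_d, hΦι, hΦι, f.app_d]
    · intro N m b b₀ s e he s' hs
      rw [hΦε]
      exact ((hα (N + 1) N N.lt_succ_self b b₀ s e he).2 s' hs).symm
  -- Splitting `f` into its fields reduces equality of morphisms to equality of their components,
  -- the other fields being proofs.
  · obtain ⟨⟨fa, _, _, _⟩, _⟩ := f
    simp only [DGOperad.Hom.comp, DGOperad.Hom.mk.injEq, GradedOperad.Hom.mk.injEq]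
    funext n c c₀ q
    exact LinearMap.ext (hΦι α c c₀ q)
  · have h : ∀ {n : ℕ} (c : Fin n → C) (c₀ : C) (q : ℤ) (x : Q.obj c c₀ q),
        p.app c c₀ q ((Φ α).app c c₀ q x) = g.app c c₀ q x := by
      refine htop ((p.toHom.comp (Φ α)).eqLocus g.toHom) ?_ ?_
      · intro n c c₀ q x
        change p.app c c₀ q ((Φ α).app c c₀ q (ι.app c c₀ q x)) = g.app c c₀ q (ι.app c c₀ q x)
        rw [hΦι]
        exact congrArg (fun F : DGOperad.Hom S Y => F.app c c₀ q x) comm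
      · intro N n c c₀ q e he
        change p.app c c₀ q ((Φ α).app c c₀ q (ε.app c c₀ q e)) = g.app c c₀ q (ε.app c c₀ q e)
        rw [hΦε]
        exact (hα (N + 1) N N.lt_succ_self c c₀ q e he).1
    obtain ⟨⟨ga, _, _, _⟩, _⟩ := g
    simp only [DGOperad.Hom.comp, DGOperad.Hom.mk.injEq, GradedOperad.Hom.mk.injEq]
    funext n c c₀ q
    exact LinearMap.ext (h c c₀ q)
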